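/- **The calculus.** Fix two disjoint infinite families of variables: ordinary variables $x,y,z,\dots$ and continuation variables $k,l,\dots$. Raw terms $M$ and jumps $J$ are given by $$M ::= x \mid \lambda x.\,M \mid MM \mid M\langle x:=M\rangle \mid \mu k.\,J,\qquad J ::= [k]M \mid J\langle x:=M\rangle ,$$ up to renaming of bound variables, where $M\langle x:=N\rangle$ stands for $\mathsf{let}\ x=N\ \mathsf{in}\ M$ and binds $x$ in $M$ only (similarly for $J\langle x:=N\rangle$), $\lambda x$ binds $x$, and $\mu k$ binds $k$. Terms and jumps of the *CCV $\lambda\mu$-calculus* are raw terms and jumps modulo the least congruence with $$L\langle x:=M\langle y:=N\rangle\rangle = L\langle x:=M\rangle\langle y:=N\rangle\ \ (y\text{ not free in }L),\qquad [k](L\langle x:=M\rangle)=([k]L)\langle x:=M\rangle .$$ Values are variables and $\lambda$-abstractions. One-step reduction on these equivalence classes is the closure under all contexts of the following ten rules, where $V$ is a value, $N$ a non-value, $L,M$ are arbitrary terms and $z$ is fresh: - $NM\to (zM)\langle z:=N\rangle$; - $VN\to (Vz)\langle z:=N\rangle$; - $(\lambda x.M)V\to M\langle x:=V\rangle$; -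 $M\langle x:=V\rangle\to M\{V/x\}$; - $M\langle x:=\mu k.J\rangle\to \mu k.\,J\{[k]\square\mapsto[k](M\langle x:=\square\rangle)\}$ with $k$ not free in $M$ (every subexpression $[k]L$ of $J$ with $k$ free is replaced, hereditarily, by $[k](M\langle x:=L\rangle)$); - $[l]\mu k.J\to J\{l/k\}$; - $\lambda x.\,Vx\to V$ if $x$ is not free in $V$; - $x\langle x:=M\rangle\to M$; - $\mu k.[k]M\to M$ if $k$ is not free in $M$; - $(\mu k.J)\langle x:=M\rangle\to\mu k.\,(J\langle x:=M\rangle)$ if $k$ is not free in $M$. A term is *strongly normalizable* if every sequence of reductions starting from it is finite. **Types.** Let a nonempty set of atomic types $\alpha$ be given. Raw types $R$, subsidiary types $S$ and types $T$ are given by $$R::=\alpha\mid S\to T,\qquad S::=R_1\cap\dots\cap R_n\ (n\ge1),\qquad T::=S_1\cup\dots\cup S_n\ (n\ge 1),$$ where $\cap$ and $\cup$ are associative and commutative. There is no empty intersection $\omega$ and no empty union. The subtype relation $\le$ is generated by the following rules: $\alpha\le\alpha$; if $S'\le S$ and $T\le T'$ then $S\to T\le S'\to T'$; if $S\le S'$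 then $S\cap S''\le S'$; if $S\le S_i$ for all $i$ then $S\le\bigcap_iS_i$; if $T\le T'$ then $T\le T''\cup T'$; if $T_i\le T$ for all $i$ then $\bigcup_iT_i\le T$. Judgements have the form $\Gamma\vdash M:T\mid\Delta$ and $\Gamma\vdash J:\bot\!\!\!\bot\mid\Delta$, where $\Gamma$ is a finite list of declarations $x:S$, $\Delta$ is a finite list of declarations $k:T$, and $\bot\!\!\!\bot$ is a special type for jumps. They are derived by the following rules, in which all index sets are finite and nonempty and $J(i)$ denotes an index set depending on $i$: - $\Gamma,x:S\vdash x:S\mid\Delta$. - If $\Gamma,x:S_i\vdash M:T_i\mid\Delta$ for all $i$, then $\Gamma\vdash\lambda x.M:\bigcap_i(S_i\to T_i)\mid\Delta$. - If $\Gamma\vdash M:\bigcup_i\bigcap_{j\in J(i)}(S_{ij}\to T)\mid\Delta$ and $\Gamma\vdash N:\bigcup_{j\in J(i)}S_{ij}\mid\Delta$ for all $i$, then $\Gamma\vdash MN:T\mid\Delta$. - If $\Gamma,x:S_i\vdash M:T\mid\Delta$ for all $i$ and $\Gamma\vdash N:\bigcup_iS_i\mid\Delta$, then $\Gamma\vdash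 M\langle x:=N\rangle:T\mid\Delta$; likewise with $J:\bot\!\!\!\bot$ in place of $M:T$, giving $\Gamma\vdash J\langle x:=N\rangle:\bot\!\!\!\bot\mid\Delta$. - If $\Gamma\vdash J:\bot\!\!\!\bot\mid\Delta,k:T$, then $\Gamma\vdash\mu k.J:T\mid\Delta$. - If $\Gamma\vdash M:T\mid\Delta,k:T$, then $\Gamma\vdash[k]M:\bot\!\!\!\bot\mid\Delta,k:T$. - If $\Gamma\vdash M:T\mid\Delta$ and $T\le T'$, then $\Gamma\vdash M:T'\mid\Delta$. A term $M$ is *typeable* if $\Gamma\vdash M:T\mid\Delta$ is derivable for some $\Gamma$, $T$, $\Delta$. **Theorem.** A term $M$ of the CCV $\lambda\mu$-calculus is strongly normalizable if and only if $M$ is typeable. -/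

import Mathlib

namespace CCV

/-! ## Syntax

Ordinary variables and continuation variables are two separate families of de Bruijn indices, so
that expressions are taken up to renaming of bound variables. -/

/-- The two syntactic categories: terms `M` and jumps `J`. -/
inductive Kind : Type
  | term
  | jump

/-- Raw expressions, before the two associativity axioms are imposed:
`M ::= x | λx.M | M N | M⟨x := N⟩ | μk.J` and `J ::= [k]M | J⟨x := N⟩`.
The constructor `letIn M N` is the let-expression `M⟨x := N⟩`, that is `let x = N in M`, for a body
`M` that is a term or a jump; it binds the ordinary index `0` in `M` only.
`lam` binds the ordinary index `0`, `mu` binds the continuation index `0`. -/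
inductive Expr : Kind → Type
  | var (x : ℕ) : Expr .term
  | lam (M : Expr .term) : Expr .term
  | app (M N : Expr .term) : Expr .term
  | letIn {s : Kind} (M : Expr s) (N : Expr .term) : Expr s
  | mu (J : Expr .jump) : Expr .term
  | jmp (k : ℕ) (M : Expr .term) : Expr .jump

/-- Extension of a renaming of indices under one binder. -/
def liftRen (f : ℕ → ℕ) : ℕ → ℕ
  | 0 => 0
  | n + 1 => f n + 1

namespace Expr

/-- Simultaneous renaming of the free ordinary variables by `f` and of the free continuation
variables by `g`. -/
def rename : {s : Kind} → Expr s → (ℕ → ℕ) → (ℕ → ℕ) → Expr s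
  | _, var x, f, _ => var (f x)
  | _, lam M, f, g => lam (M.rename (liftRen f) g)
  | _, app M N, f, g => app (M.rename f g) (N.rename f g)
  | _, letIn M N, f, g => letIn (M.rename (liftRen f) g) (N.rename f g)
  | _, mu J, f, g => mu (J.rename f (liftRen g))
  | _, jmp k M, f, g => jmp (g k) (M.rename f g)

/-- Weakening by one fresh ordinary variable, which receives the index `0`. -/
def shiftVar {s : Kind} (M : Expr s) : Expr s := M.rename Nat.succ id

/-- Weakening by one fresh continuation variable, which receives the index `0`. -/
def shiftCont {s : Kind} (M : Expr s) : Expr s := M.rename id Nat.succ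

/-- Weakening of an expression that already has a distinguished ordinary variable `0`, by a fresh
ordinary variable, which receives the index `1`. -/
def shiftVarUnder {s : Kind} (M : Expr s) : Expr s := M.rename (liftRen Nat.succ) id

/-- Extension of a substitution under a binder of an ordinary variable. -/
def liftSubst (σ : ℕ → Expr .term) : ℕ → Expr .term
  | 0 => var 0
  | n + 1 => (σ n).shiftVar

/-- Simultaneous capture-avoiding substitution for the ordinary variables. -/
def subst : {s : Kind} → Expr s → (ℕ → Expr .term) → Expr s
  | _, var x, σ => σ x
  | _, lam M, σ => lam (M.subst (liftSubst σ))
  | _, app M N, σ => app (M.subst σ) (N.subst σ)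
  | _, letIn M N, σ => letIn (M.subst (liftSubst σ)) (N.subst σ)
  | _, mu J, σ => mu (J.subst fun n => (σ n).shiftCont)
  | _, jmp k M, σ => jmp k (M.subst σ)

/-- `M{V/x}` where `x` is the ordinary variable `0`, which is removed. -/
def inst {s : Kind} (M : Expr s) (V : Expr .term) : Expr s :=
  M.subst fun
    | 0 => V
    | n + 1 => var n

/-- `J{l/k}` where `k` is the continuation variable `0`, which is removed. -/
def instCont {s : Kind} (J : Expr s) (l : ℕ) : Expr s :=
  J.rename id fun
    | 0 => l
    | n + 1 => n

/-- The context substitution `P{[k]□ ↦ [k](M⟨x := □⟩)}`, performed hereditarily on all free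
occurrences of `k` in `P`. In `M`, the bound variable `x` is the ordinary variable `0`. -/
def ctxSubst : {s : Kind} → Expr s → ℕ → Expr .term → Expr s
  | _, var x, _, _ => var x
  | _, lam P, k, M => lam (P.ctxSubst k M.shiftVarUnder)
  | _, app P Q, k, M => app (P.ctxSubst k M) (Q.ctxSubst k M)
  | _, letIn P Q, k, M => letIn (P.ctxSubst k M.shiftVarUnder) (Q.ctxSubst k M)
  | _, mu P, k, M => mu (P.ctxSubst (k + 1) M.shiftCont)
  | _, jmp l P, k, M =>
      if l = k then jmp l (letIn M (P.ctxSubst k M)) else jmp l (P.ctxSubst k M)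

/-- Values: ordinary variables and lambda abstractions. -/
inductive IsValue : Expr .term → Prop
  | var (x : ℕ) : IsValue (var x)
  | lam (M : Expr .term) : IsValue (lam M)

/-- The syntactic equality: the least congruence containing
`L⟨x := M⟨y := N⟩⟩ = L⟨x := M⟩⟨y := N⟩` for `y` not free in `L`, and
`[k](L⟨x := M⟩) = ([k]L)⟨x := M⟩`. -/
inductive Eqv : {s : Kind} → Expr s → Expr s → Prop
  | assoc (L M N : Expr .term) :
      Eqv (letIn L (letIn M N)) (letIn (letIn L.shiftVarUnder M) N)
  | jmpLet (k : ℕ) (L M : Expr .term) :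
      Eqv (jmp k (letIn L M)) (letIn (jmp k L) M)
  | refl {s : Kind} (M : Expr s) : Eqv M M
  | symm {s : Kind} {M N : Expr s} : Eqv M N → Eqv N M
  | trans {s : Kind} {L M N : Expr s} : Eqv L M → Eqv M N → Eqv L N
  | lam {M M' : Expr .term} : Eqv M M' → Eqv (lam M) (lam M')
  | app {M M' N N' : Expr .term} : Eqv M M' → Eqv N N' → Eqv (app M N) (app M' N')
  | letIn {s : Kind} {M M' : Expr s} {N N' : Expr .term} :
      Eqv M M' → Eqv N N' → Eqv (letIn M N) (letIn M' N')
  | mu {J J' : Expr .jump} : Eqv J J' → Eqv (mu J) (mu J')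
  | jmp (k : ℕ) {M M' : Expr .term} : Eqv M M' → Eqv (jmp k M) (jmp k M')

/-- One-step reduction of raw expressions: the ten rules, closed under all contexts. -/
inductive Step : {s : Kind} → Expr s → Expr s → Prop
  | ad₁ {N : Expr .term} (M : Expr .term) (hN : ¬ IsValue N) :
      Step (app N M) (letIn (app (var 0) M.shiftVar) N)
  | ad₂ {V N : Expr .term} (hV : IsValue V) (hN : ¬ IsValue N) :
      Step (app V N) (letIn (app V.shiftVar (var 0)) N)
  | betaLam (M : Expr .term) {V : Expr .term} (hV : IsValue V) :
      Step (app (lam M) V) (letIn M V)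
  | betaLet (M : Expr .term) {V : Expr .term} (hV : IsValue V) :
      Step (letIn M V) (M.inst V)
  | betaMu (M : Expr .term) (J : Expr .jump) :
      Step (letIn M (mu J)) (mu (J.ctxSubst 0 M.shiftCont))
  | betaJmp (l : ℕ) (J : Expr .jump) :
      Step (jmp l (mu J)) (J.instCont l)
  | etaLam {V : Expr .term} (hV : IsValue V) :
      Step (lam (app V.shiftVar (var 0))) V
  | etaLet (M : Expr .term) :
      Step (letIn (var 0) M) M
  | etaMu (M : Expr .term) :
      Step (mu (jmp 0 M.shiftCont)) M
  | exch (J : Expr .jump) (M : Expr .term) :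
      Step (letIn (mu J) M) (mu (letIn J M.shiftCont))
  | lam {M M' : Expr .term} : Step M M' → Step (lam M) (lam M')
  | appLeft {M M' : Expr .term} (N : Expr .term) : Step M M' → Step (app M N) (app M' N)
  | appRight (M : Expr .term) {N N' : Expr .term} : Step N N' → Step (app M N) (app M N')
  | letBody {s : Kind} {M M' : Expr s} (N : Expr .term) :
      Step M M' → Step (letIn M N) (letIn M' N)
  | letArg {s : Kind} (M : Expr s) {N N' : Expr .term} :
      Step N N' → Step (letIn M N) (letIn M N')
  | mu {J J' : Expr .jump} : Step J J' → Step (mu J) (mu J')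
  | jmp (k : ℕ) {M M' : Expr .term} : Step M M' → Step (jmp k M) (jmp k M')

/-- The syntactic equality as a setoid. -/
def eqvSetoid (s : Kind) : Setoid (Expr s) where
  r := Eqv
  iseqv := ⟨Eqv.refl, Eqv.symm, Eqv.trans⟩

end Expr

/-- Terms of the CCV λμ-calculus: raw terms modulo the syntactic equality. -/
def Term : Type := Quotient (Expr.eqvSetoid .term)

/-- The term represented by a raw term. -/
def Term.mk (M : Expr .term) : Term := Quotient.mk (Expr.eqvSetoid .term) M

/-- One-step reduction of terms: any representatives may be used on both sides. -/
def Term.Red (a b : Term) : Prop :=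
  ∃ M N : Expr .term, Term.mk M = a ∧ Term.mk N = b ∧ Expr.Step M N

/-- Strong normalizability: all reduction sequences from `a` are finite, expressed as
accessibility. -/
def Term.StronglyNormalizable (a : Term) : Prop :=
  Acc (fun c b : Term => Term.Red b c) a

/-! ## Union-intersection types -/

/-- The three categories of types. -/
inductive Level : Type
  | raw
  | sub
  | typ

/-- Raw types `R ::= α | S → T`, subsidiary types `S ::= ⋂ R` and types `T ::= ⋃ S`, where
`inter n R` is `R 0 ∩ ⋯ ∩ R n` and `union n S` is `S 0 ∪ ⋯ ∪ S n`; so there is neither an empty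
intersection nor an empty union. Unary intersections and unions give the inclusions of raw types
into subsidiary types and of subsidiary types into types. -/
inductive Ty (Atom : Type*) : Level → Type _
  | atom (α : Atom) : Ty Atom .raw
  | arr (S : Ty Atom .sub) (T : Ty Atom .typ) : Ty Atom .raw
  | inter (n : ℕ) (R : Fin (n + 1) → Ty Atom .raw) : Ty Atom .sub
  | union (n : ℕ) (S : Fin (n + 1) → Ty Atom .sub) : Ty Atom .typ

/-- A subsidiary type regarded as a type (a unary union). -/
def Ty.ofSub {Atom : Type*} (S : Ty Atom .sub) : Ty Atom .typ := .union 0 fun _ => S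

/-- The subtype relation. An intersection `⋂ᵢ Rᵢ` is below `⋂ⱼ R'ⱼ` if each `R'ⱼ` is above one of the
`Rᵢ`; this is the combination of the two rules "`S ≤ S'` implies `S ∩ S'' ≤ S'`" and "`S ≤ Sᵢ` for
all `i` implies `S ≤ ⋂ᵢ Sᵢ`". Dually for unions. Intersections (unions) that differ only in the
order of their members are thereby below each other. -/
inductive Ty.Le {Atom : Type*} : {l : Level} → Ty Atom l → Ty Atom l → Prop
  | atom (α : Atom) : Le (.atom α) (.atom α)
  | arr {S S' : Ty Atom .sub} {T T' : Ty Atom .typ} :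
      Le S' S → Le T T' → Le (.arr S T) (.arr S' T')
  | inter {n m : ℕ} {R : Fin (n + 1) → Ty Atom .raw} {R' : Fin (m + 1) → Ty Atom .raw}
      (f : Fin (m + 1) → Fin (n + 1)) :
      (∀ j, Le (R (f j)) (R' j)) → Le (.inter n R) (.inter m R')
  | union {n m : ℕ} {S : Fin (n + 1) → Ty Atom .sub} {S' : Fin (m + 1) → Ty Atom .sub}
      (f : Fin (n + 1) → Fin (m + 1)) :
      (∀ i, Le (S i) (S' (f i))) → Le (.union n S) (.union m S')

/-- The right-hand side of a typing judgement: a type for a term, the special type `⊥⊥` for a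
jump. -/
inductive Res (Atom : Type*) : Kind → Type _
  | ty (T : Ty Atom .typ) : Res Atom .term
  | bot : Res Atom .jump

/-- Typing judgements `Γ ⊢ M : T | Δ` and `Γ ⊢ J : ⊥⊥ | Δ`. The environment `Γ` lists the subsidiary
types of the ordinary variables `0, 1, …`, and `Δ` the types of the continuation variables
`0, 1, …`. The rule `letIn` covers let-expressions whose body is a term or a jump. The rule `eqv`
expresses that expressions are identified up to the syntactic equality. -/
inductive Typing {Atom : Type*} :
    List (Ty Atom .sub) → {s : Kind} → Expr s → Res Atom s → List (Ty Atom .typ) → Prop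
  | var {Γ : List (Ty Atom .sub)} {Δ : List (Ty Atom .typ)} {x : ℕ} {S : Ty Atom .sub} :
      Γ[x]? = some S → Typing Γ (.var x) (.ty (.ofSub S)) Δ
  | lam {Γ : List (Ty Atom .sub)} {Δ : List (Ty Atom .typ)} {M : Expr .term} (n : ℕ)
      (S : Fin (n + 1) → Ty Atom .sub) (T : Fin (n + 1) → Ty Atom .typ) :
      (∀ i, Typing (S i :: Γ) M (.ty (T i)) Δ) →
      Typing Γ (.lam M) (.ty (.ofSub (.inter n fun i => .arr (S i) (T i)))) Δ
  | app {Γ : List (Ty Atom .sub)} {Δ : List (Ty Atom .typ)} {M N : Expr .term} (n : ℕ)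
      (m : Fin (n + 1) → ℕ) (S : (i : Fin (n + 1)) → Fin (m i + 1) → Ty Atom .sub)
      (T : Ty Atom .typ) :
      Typing Γ M (.ty (.union n fun i => .inter (m i) fun j => .arr (S i j) T)) Δ →
      (∀ i, Typing Γ N (.ty (.union (m i) fun j => S i j)) Δ) →
      Typing Γ (.app M N) (.ty T) Δ
  | letIn {Γ : List (Ty Atom .sub)} {Δ : List (Ty Atom .typ)} {s : Kind} {M : Expr s}
      {N : Expr .term} (n : ℕ) (S : Fin (n + 1) → Ty Atom .sub) (ρ : Res Atom s) :
      (∀ i, Typing (S i :: Γ) M ρ Δ) →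
      Typing Γ N (.ty (.union n S)) Δ →
      Typing Γ (.letIn M N) ρ Δ
  | mu {Γ : List (Ty Atom .sub)} {Δ : List (Ty Atom .typ)} {J : Expr .jump} {T : Ty Atom .typ} :
      Typing Γ J .bot (T :: Δ) → Typing Γ (.mu J) (.ty T) Δ
  | jmp {Γ : List (Ty Atom .sub)} {Δ : List (Ty Atom .typ)} {k : ℕ} {M : Expr .term}
      {T : Ty Atom .typ} :
      Δ[k]? = some T → Typing Γ M (.ty T) Δ → Typing Γ (.jmp k M) .bot Δ
  | sub {Γ : List (Ty Atom .sub)} {Δ : List (Ty Atom .typ)} {M : Expr .term}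
      {T T' : Ty Atom .typ} :
      Typing Γ M (.ty T) Δ → Ty.Le T T' → Typing Γ M (.ty T') Δ
  | eqv {Γ : List (Ty Atom .sub)} {Δ : List (Ty Atom .typ)} {s : Kind} {M M' : Expr s}
      {ρ : Res Atom s} :
      Typing Γ M ρ Δ → Expr.Eqv M M' → Typing Γ M' ρ Δ

/-- A term is typeable if `Γ ⊢ M : T | Δ` is derivable for some `Γ`, `T` and `Δ`. -/
def Term.Typeable (Atom : Type*) (a : Term) : Prop :=
  ∃ (M : Expr .term) (Γ : List (Ty Atom .sub)) (T : Ty Atom .typ) (Δ : List (Ty Atom .typ)),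
    Term.mk M = a ∧ Typing Γ M (.ty T) Δ

end CCV

/-!
Strong normalizability and typeability are compared by two independent arguments.

*Typeable terms are strongly normalizable.* Terms are translated into continuation-passing style:
`tr M σ δ K` is the translation `{M}K` of `M` with continuation `K`, and `{M⟨x := N⟩}K` is
`{N}(λx.{M}K)`. In this form the two syntactic equalities become identities. A plain λ-calculus is
not a suitable target. If `{μk.J}K` were `(λk.{J})K`, then the structural rules for `μ` would not be
reductions of the translations, and if it were `{J}` with `K` for `k`, then `K`, and the reductions
inside `K`, would be lost when `k` does not occur in `J`. Therefore the target calculus `Tm` has terms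
`mem t g`, which behave like `t` but store the garbage `g`, and `{μk.J}K` is `mem {J} K` with `K`
substituted for `k`. Garbage may reduce, shrink to a part of itself, move outwards, and be dropped.
With these rules each reduction step of the CCV λμ-calculus is simulated by at least one step of the
target calculus (`Expr.Step.redp`). The target calculus admits Girard's reducibility candidates
(`Tm.Cand`); a type `T` is interpreted by the set of continuations that accept its values, which
gives a meaning to unions, and the translations of typed expressions are strongly normalizable
(`Typing.sn_tr`).

*Strongly normalizable terms are typeable.* The type system is put into a syntax-directed form
(`HasType`), for which inversion is immediate. Types are carried backwards along the reductions that
a let-expression or an application admits at its root or in the argument of the let-expression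
(subject expansion, `HasType.of_subst`, `HasType.of_ctxSubst` and the lemmas after them);
the occurrences of a substituted value, or of a continuation variable, have types that are collected
in an intersection, or in a union. What a reduction may erase is a proper subexpression and is
typed on its own. The `η`-rules and the exchange rule are not needed. The whole is an induction
on strong normalizability and on the size of expressions
(`Term.StronglyNormalizable.isTypeable`).
-/

namespace CCV

/-! ### A λ-calculus with memory -/

/-- Terms of the target calculus: untyped λ-terms with de Bruijn indices and one more constructor
`mem t g`, which behaves like `t` and keeps the term `g` as garbage. -/
inductive Tm : Type
  | var (x : ℕ)
  | lam (t : Tm)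
  | app (t s : Tm)
  | mem (t g : Tm)

/-- Prefixing a sequence by an element. -/
def scons {α : Type*} (a : α) (f : ℕ → α) : ℕ → α
  | 0 => a
  | n + 1 => f n

@[simp] theorem scons_zero {α : Type*} (a : α) (f : ℕ → α) : scons a f 0 = a := rfl

@[simp] theorem scons_succ {α : Type*} (a : α) (f : ℕ → α) (n : ℕ) :
    scons a f (n + 1) = f n := rfl

theorem scons_comp_succ {α : Type*} (a : α) (f : ℕ → α) :
    (fun n => scons a f (Nat.succ n)) = f := rfl

theorem comp_scons {α β : Type*} (h : α → β) (a : α) (f : ℕ → α) :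
    (fun n => h (scons a f n)) = scons (h a) fun n => h (f n) := by
  funext n; cases n <;> rfl

theorem scons_comp_liftRen {α : Type*} (a : α) (f : ℕ → α) (r : ℕ → ℕ) :
    (fun n => scons a f (liftRen r n)) = scons a fun n => f (r n) := by
  funext n; cases n <;> rfl

theorem liftRen_liftRen (f g : ℕ → ℕ) :
    (fun n => liftRen f (liftRen g n)) = liftRen fun n => f (g n) := by
  funext n; cases n <;> rfl

namespace Tm

/-- Renaming of the free variables. -/
def rename : Tm → (ℕ → ℕ) → Tm
  | var x, f => var (f x)
  | lam t, f => lam (t.rename (liftRen f))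
  | app t s, f => app (t.rename f) (s.rename f)
  | mem t g, f => mem (t.rename f) (g.rename f)

/-- Weakening by one fresh variable, which receives the index `0`. -/
def shift (t : Tm) : Tm := t.rename Nat.succ

/-- Extension of a substitution under a binder. -/
def liftS (τ : ℕ → Tm) : ℕ → Tm := scons (var 0) fun n => (τ n).shift

/-- Simultaneous capture-avoiding substitution. -/
def subst : Tm → (ℕ → Tm) → Tm
  | var x, τ => τ x
  | lam t, τ => lam (t.subst (liftS τ))
  | app t s, τ => app (t.subst τ) (s.subst τ)
  | mem t g, τ => mem (t.subst τ) (g.subst τ)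

/-- Substitution of `s` for the variable `0`, which is removed. -/
def inst (t s : Tm) : Tm := t.subst (scons s var)

/-- Number of constructors. -/
def size : Tm → ℕ
  | var _ => 1
  | lam t => t.size + 1
  | app t s => t.size + s.size + 1
  | mem t g => t.size + g.size + 1

theorem rename_rename (t : Tm) (f g : ℕ → ℕ) :
    (t.rename f).rename g = t.rename fun n => g (f n) := by
  induction t generalizing f g with
  | var x => rfl
  | lam t ih => simp only [rename, ih, liftRen_liftRen]
  | app t s iht ihs => simp only [rename, iht, ihs]
  | mem t s iht ihs => simp only [rename, iht, ihs]

theorem liftS_comp_liftRen (τ : ℕ → Tm) (f : ℕ → ℕ) :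
    (fun n => liftS τ (liftRen f n)) = liftS fun n => τ (f n) := by
  funext n; cases n <;> rfl

theorem subst_rename (t : Tm) (f : ℕ → ℕ) (τ : ℕ → Tm) :
    (t.rename f).subst τ = t.subst fun n => τ (f n) := by
  induction t generalizing f τ with
  | var x => rfl
  | lam t ih => simp only [rename, subst, ih, liftS_comp_liftRen]
  | app t s iht ihs => simp only [rename, subst, iht, ihs]
  | mem t s iht ihs => simp only [rename, subst, iht, ihs]

theorem rename_shift (t : Tm) (f : ℕ → ℕ) :
    t.shift.rename (liftRen f) = (t.rename f).shift := by
  simp only [shift, rename_rename]; rfl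

theorem rename_comp_liftS (τ : ℕ → Tm) (f : ℕ → ℕ) :
    (fun n => (liftS τ n).rename (liftRen f)) = liftS fun n => (τ n).rename f := by
  funext n
  cases n with
  | zero => rfl
  | succ n => exact rename_shift _ _

theorem rename_subst (t : Tm) (τ : ℕ → Tm) (f : ℕ → ℕ) :
    (t.subst τ).rename f = t.subst fun n => (τ n).rename f := by
  induction t generalizing f τ with
  | var x => rfl
  | lam t ih => simp only [rename, subst, ih, rename_comp_liftS]
  | app t s iht ihs => simp only [rename, subst, iht, ihs]
  | mem t s iht ihs => simp only [rename, subst, iht, ihs]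

theorem subst_shift (t : Tm) (τ : ℕ → Tm) : t.shift.subst (liftS τ) = (t.subst τ).shift := by
  simp only [shift, subst_rename, rename_subst]; rfl

theorem subst_comp_liftS (τ υ : ℕ → Tm) :
    (fun n => (liftS τ n).subst (liftS υ)) = liftS fun n => (τ n).subst υ := by
  funext n
  cases n with
  | zero => rfl
  | succ n => exact subst_shift _ _

theorem subst_subst (t : Tm) (τ υ : ℕ → Tm) :
    (t.subst τ).subst υ = t.subst fun n => (τ n).subst υ := by
  induction t generalizing τ υ with
  | var x => rfl
  | lam t ih => simp only [subst, ih, subst_comp_liftS]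
  | app t s iht ihs => simp only [subst, iht, ihs]
  | mem t s iht ihs => simp only [subst, iht, ihs]

theorem liftS_var : liftS var = var := by funext n; cases n <;> rfl

@[simp] theorem subst_var (t : Tm) : t.subst var = t := by
  induction t with
  | var x => rfl
  | lam t ih => simp only [subst, liftS_var, ih]
  | app t s iht ihs => simp only [subst, iht, ihs]
  | mem t s iht ihs => simp only [subst, iht, ihs]

theorem rename_eq_subst (t : Tm) (f : ℕ → ℕ) : t.rename f = t.subst fun n => var (f n) := by
  have h := subst_rename t f var
  rwa [subst_var] at h

@[simp] theorem shift_inst (t s : Tm) : t.shift.inst s = t := by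
  rw [shift, inst, subst_rename]; exact subst_var t

/-- Substitution commutes with instantiation of the variable `0`. -/
theorem inst_subst (t s : Tm) (τ : ℕ → Tm) :
    (t.inst s).subst τ = (t.subst (liftS τ)).inst (s.subst τ) := by
  simp only [inst, subst_subst]
  congr 1
  funext n
  cases n with
  | zero => rfl
  | succ n => exact (shift_inst _ _).symm

theorem size_rename (t : Tm) (f : ℕ → ℕ) : (t.rename f).size = t.size := by
  induction t generalizing f with
  | var x => rfl
  | lam t ih => simp only [rename, size, ih]
  | app t s iht ihs => simp only [rename, size, iht, ihs]
  | mem t s iht ihs => simp only [rename, size, iht, ihs]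

/-- `Sub g u`: the term `u` is a subterm of `g`, and none of its free variables is bound at that
place of `g`. -/
inductive Sub : Tm → Tm → Prop
  | refl (t : Tm) : Sub t t
  | lam {t u : Tm} : Sub t u.shift → Sub (lam t) u
  | appLeft {t u : Tm} (s : Tm) : Sub t u → Sub (app t s) u
  | appRight (t : Tm) {s u : Tm} : Sub s u → Sub (app t s) u
  | memLeft {t u : Tm} (s : Tm) : Sub t u → Sub (mem t s) u
  | memRight (t : Tm) {s u : Tm} : Sub s u → Sub (mem t s) u

/-- The irreflexive part of `Sub`. -/
inductive SSub : Tm → Tm → Prop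
  | lam {t u : Tm} : Sub t u.shift → SSub (lam t) u
  | appLeft {t u : Tm} (s : Tm) : Sub t u → SSub (app t s) u
  | appRight (t : Tm) {s u : Tm} : Sub s u → SSub (app t s) u
  | memLeft {t u : Tm} (s : Tm) : Sub t u → SSub (mem t s) u
  | memRight (t : Tm) {s u : Tm} : Sub s u → SSub (mem t s) u

theorem SSub.sub {g u : Tm} (h : SSub g u) : Sub g u := by
  cases h with
  | lam h => exact .lam h
  | appLeft s h => exact .appLeft s h
  | appRight s h => exact .appRight s h
  | memLeft s h => exact .memLeft s h
  | memRight s h => exact .memRight s h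

theorem Sub.size_le {g u : Tm} (h : Sub g u) : u.size ≤ g.size := by
  induction h with
  | refl => exact le_rfl
  | lam _ ih => simp only [size, shift, size_rename] at *; omega
  | appLeft _ _ ih | appRight _ _ ih | memLeft _ _ ih | memRight _ _ ih =>
    simp only [size]; omega

theorem SSub.size_lt {g u : Tm} (h : SSub g u) : u.size < g.size := by
  cases h with
  | lam h => have := h.size_le; simp only [size, shift, size_rename] at *; omega
  | appLeft _ h | appRight _ h | memLeft _ h | memRight _ h =>
    have := h.size_le; simp only [size]; omega

theorem Sub.subst {g u : Tm} (h : Sub g u) (τ : ℕ → Tm) : Sub (g.subst τ) (u.subst τ) := by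
  induction h generalizing τ with
  | refl => exact .refl _
  | lam _ ih => exact .lam (by simpa only [subst_shift] using ih (liftS τ))
  | appLeft s _ ih => exact .appLeft _ (ih τ)
  | appRight s _ ih => exact .appRight _ (ih τ)
  | memLeft s _ ih => exact .memLeft _ (ih τ)
  | memRight s _ ih => exact .memRight _ (ih τ)

theorem SSub.subst {g u : Tm} (h : SSub g u) (τ : ℕ → Tm) : SSub (g.subst τ) (u.subst τ) := by
  cases h with
  | lam h => exact .lam (by simpa only [subst_shift] using h.subst (liftS τ))
  | appLeft s h => exact .appLeft _ (h.subst τ)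
  | appRight s h => exact .appRight _ (h.subst τ)
  | memLeft s h => exact .memLeft _ (h.subst τ)
  | memRight s h => exact .memRight _ (h.subst τ)

theorem Sub.shift {g u : Tm} (h : Sub g u) : Sub g.shift u.shift := by
  simpa only [Tm.shift, rename_eq_subst] using h.subst _

theorem Sub.trans {g u v : Tm} (h : Sub g u) (h' : Sub u v) : Sub g v := by
  induction h generalizing v with
  | refl => exact h'
  | lam _ ih => exact .lam (ih h'.shift)
  | appLeft s _ ih => exact .appLeft _ (ih h')
  | appRight s _ ih => exact .appRight _ (ih h')
  | memLeft s _ ih => exact .memLeft _ (ih h')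
  | memRight s _ ih => exact .memRight _ (ih h')

/-- One-step reduction of the target calculus: `β` and `η`; garbage may be dropped (`drop`) or
replaced by a part of itself (`extract`), and it may move outwards past applications, abstractions
that do not bind it, and other garbage (`floatFun`, `floatArg`, `floatLam`, `floatMem`). -/
inductive Red : Tm → Tm → Prop
  | beta (t s : Tm) : Red (app (lam t) s) (t.inst s)
  | eta (t : Tm) : Red (lam (app t.shift (var 0))) t
  | drop (t g : Tm) : Red (mem t g) t
  | extract (t : Tm) {g u : Tm} : SSub g u → Red (mem t g) (mem t u)
  | floatFun (t g s : Tm) : Red (app (mem t g) s) (mem (app t s) g)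
  | floatArg (s t g : Tm) : Red (app s (mem t g)) (mem (app s t) g)
  | floatLam (t g : Tm) : Red (lam (mem t g.shift)) (mem (lam t) g)
  | floatMem (s t g : Tm) : Red (mem s (mem t g)) (mem (mem s t) g)
  | lam {t t' : Tm} : Red t t' → Red (lam t) (lam t')
  | appLeft {t t' : Tm} (s : Tm) : Red t t' → Red (app t s) (app t' s)
  | appRight (t : Tm) {s s' : Tm} : Red s s' → Red (app t s) (app t s')
  | memLeft {t t' : Tm} (s : Tm) : Red t t' → Red (mem t s) (mem t' s)
  | memRight (t : Tm) {s s' : Tm} : Red s s' → Red (mem t s) (mem t s')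

theorem Red.subst {t t' : Tm} (h : Red t t') (τ : ℕ → Tm) : Red (t.subst τ) (t'.subst τ) := by
  induction h generalizing τ with
  | beta t s => rw [inst_subst]; exact .beta _ _
  | eta t =>
    have h := Red.eta (t.subst τ)
    rwa [← subst_shift] at h
  | drop t g => exact .drop _ _
  | extract t h => exact .extract _ (h.subst τ)
  | floatFun t g s => exact .floatFun _ _ _
  | floatArg s t g => exact .floatArg _ _ _
  | floatLam t g =>
    have h := Red.floatLam (t.subst (liftS τ)) (g.subst τ)
    rwa [← subst_shift] at h
  | floatMem s t g => exact .floatMem _ _ _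
  | lam _ ih => exact .lam (ih _)
  | appLeft s _ ih => exact .appLeft _ (ih _)
  | appRight t _ ih => exact .appRight _ (ih _)
  | memLeft s _ ih => exact .memLeft _ (ih _)
  | memRight t _ ih => exact .memRight _ (ih _)

theorem Red.shift {t t' : Tm} (h : Red t t') : Red t.shift t'.shift := by
  simpa only [Tm.shift, rename_eq_subst] using h.subst _

/-- Reductions of a subterm lift to the whole term. -/
theorem Sub.red {g u u' : Tm} (h : Sub g u) (hr : Red u u') : ∃ g', Red g g' ∧ Sub g' u' := by
  induction h generalizing u' with
  | refl => exact ⟨_, hr, .refl _⟩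
  | lam _ ih => obtain ⟨g', h, h'⟩ := ih hr.shift; exact ⟨_, .lam h, .lam h'⟩
  | appLeft s _ ih => obtain ⟨g', h, h'⟩ := ih hr; exact ⟨_, .appLeft _ h, .appLeft _ h'⟩
  | appRight s _ ih => obtain ⟨g', h, h'⟩ := ih hr; exact ⟨_, .appRight _ h, .appRight _ h'⟩
  | memLeft s _ ih => obtain ⟨g', h, h'⟩ := ih hr; exact ⟨_, .memLeft _ h, .memLeft _ h'⟩
  | memRight s _ ih => obtain ⟨g', h, h'⟩ := ih hr; exact ⟨_, .memRight _ h, .memRight _ h'⟩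

/-! ### Strong normalization and reducibility candidates -/

/-- Strong normalizability in the target calculus. -/
def SN (t : Tm) : Prop := Acc (fun s t => Red t s) t

theorem SN.red {t t' : Tm} (h : SN t) (hr : Red t t') : SN t' := Acc.inv h hr

/-- If `φ` preserves reduction steps and `φ t` is strongly normalizable, then so is `t`. -/
theorem SN.of_map {φ : Tm → Tm} (hφ : ∀ {t t'}, Red t t' → Red (φ t) (φ t')) {t : Tm}
    (h : SN (φ t)) : SN t :=
  Subrelation.accessible (fun h => hφ h) (InvImage.accessible φ h)

theorem SN.of_shift {t : Tm} (h : SN t.shift) : SN t := h.of_map Red.shift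

/-- A strongly normalizable term is also accessible when passing to subterms is allowed between
reduction steps. -/
theorem SN.acc_sub {g : Tm} (h : SN g) : Acc (fun s t => Red t s ∨ SSub t s) g := by
  suffices H : ∀ u, Sub g u → Acc (fun s t => Red t s ∨ SSub t s) u from H g (.refl g)
  induction h with
  | intro g _ ih =>
    intro u
    induction hn : u.size using Nat.strong_induction_on generalizing u with
    | _ n ihn =>
      intro hu
      refine ⟨_, fun v hv => ?_⟩
      rcases hv with hv | hv
      · obtain ⟨g', hg, hs⟩ := hu.red hv
        exact ih g' hg v hs
      · exact ihn _ (hn ▸ hv.size_lt) v rfl (hu.trans hv.sub)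

/-- Reducibility candidates in the sense of Girard; the neutral terms are those that are not
abstractions. -/
structure Cand (X : Set Tm) : Prop where
  sn : ∀ {t}, t ∈ X → SN t
  red : ∀ {t t'}, t ∈ X → Red t t' → t' ∈ X
  neutral : ∀ {t}, (∀ u, t ≠ lam u) → (∀ t', Red t t' → t' ∈ X) → t ∈ X

theorem cand_sn : Cand {t | SN t} where
  sn h := h
  red h hr := SN.red h hr
  neutral _ h := ⟨_, h⟩

theorem Cand.var {X : Set Tm} (hX : Cand X) (x : ℕ) : var x ∈ X :=
  hX.neutral (by simp) fun _ h => nomatch h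

/-- Adding strongly normalizable garbage does not lead out of a candidate. -/
theorem Cand.mem {X : Set Tm} (hX : Cand X) {t g : Tm} (ht : t ∈ X) (hg : SN g) :
    mem t g ∈ X := by
  have hg' := hg.acc_sub
  clear hg
  induction hg' generalizing t with
  | intro g _ ihg =>
    have hs := hX.sn ht
    induction hs with
    | intro t _ iht =>
      refine hX.neutral (by simp) fun t' hr => ?_
      cases hr with
      | drop => exact ht
      | extract _ h => exact ihg _ (.inr h) ht
      | floatMem _ u g =>
        exact ihg _ (.inr (.memRight _ (.refl _))) (ihg _ (.inl (.drop _ _)) ht)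
      | memLeft _ h => exact iht _ h (hX.red ht h)
      | memRight _ h => exact ihg _ (.inl h) ht

/-- The terms that map `X` into `Y`. -/
def arrow (X Y : Set Tm) : Set Tm := {t | ∀ s ∈ X, app t s ∈ Y}

theorem Cand.arrow {X Y : Set Tm} (hX : Cand X) (hY : Cand Y) : Cand (arrow X Y) where
  sn {t} h := SN.of_map (φ := fun t => app t (.var 0)) (fun hr => .appLeft _ hr)
    (hY.sn (h _ (hX.var 0)))
  red h hr s hs := hY.red (h s hs) (.appLeft _ hr)
  neutral {t} hn h s hs := by
    have hsn := hX.sn hs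
    induction hsn with
    | intro s _ ih =>
      refine hY.neutral (by simp) fun t' hr => ?_
      cases hr with
      | beta u => exact absurd rfl (hn u)
      | floatFun u g =>
        refine hY.mem (h u (.drop _ _) s hs) ?_
        refine SN.of_map (φ := Tm.mem u) (fun hr => .memRight _ hr) ⟨_, fun t' ht' => ?_⟩
        exact SN.of_map (φ := fun t => app t (.var 0)) (fun hr => .appLeft _ hr)
          (hY.sn (h _ ht' _ (hX.var 0)))
      | floatArg _ u g =>
        refine hY.mem (ih u (.drop _ _) (hX.red hs (.drop _ _))) ?_
        exact SN.of_map (φ := Tm.mem u) (fun hr => .memRight _ hr) (hX.sn hs)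
      | appLeft _ hr => exact h _ hr s hs
      | appRight _ hr => exact ih _ hr (hX.red hs hr)

/-- An abstraction all of whose instances lie in `Y` maps `X` into `Y`. -/
theorem Cand.lam {X Y : Set Tm} (hX : Cand X) (hY : Cand Y) {t : Tm}
    (h : ∀ s ∈ X, t.inst s ∈ Y) : Tm.lam t ∈ Tm.arrow X Y := by
  have ht : SN t := SN.of_map (φ := fun t => t.inst (.var 0)) (fun hr => hr.subst _)
    (hY.sn (h _ (hX.var 0)))
  induction ht with
  | intro t ht iht =>
    intro s hs
    have hsn := hX.sn hs
    induction hsn with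
    | intro s _ ihs =>
      refine hY.neutral (by simp) fun t' hr => ?_
      cases hr with
      | beta => exact h s hs
      | floatArg _ u g =>
        refine hY.mem (ihs u (.drop _ _) (hX.red hs (.drop _ _))) ?_
        exact SN.of_map (φ := Tm.mem u) (fun hr => .memRight _ hr) (hX.sn hs)
      | @appLeft _ r _ hr =>
        cases hr with
        | eta =>
          have hu : app (r.shift.inst s) s ∈ Y := h s hs
          rwa [shift_inst] at hu
        | floatLam u g =>
          refine (hX.arrow hY).mem (iht u (.drop _ _) fun s hs => hY.red (h s hs) (.drop _ _)) ?_ s hs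
          exact SN.of_shift (SN.of_map (φ := Tm.mem u) (fun hr => .memRight _ hr) ⟨_, ht⟩)
        | lam hr => exact iht _ hr (fun s hs => hY.red (h s hs) (hr.subst _)) s hs
      | appRight _ hr => exact ihs _ hr (hX.red hs hr)

theorem Cand.iInter {ι : Type*} [Nonempty ι] {X : ι → Set Tm} (h : ∀ i, Cand (X i)) :
    Cand (⋂ i, X i) where
  sn ht := (h (Classical.arbitrary ι)).sn (Set.mem_iInter.1 ht _)
  red ht hr := Set.mem_iInter.2 fun i => (h i).red (Set.mem_iInter.1 ht i) hr
  neutral hn ht := Set.mem_iInter.2 fun i =>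
    (h i).neutral hn fun t' hr => Set.mem_iInter.1 (ht t' hr) i

end Tm

/-! ### The continuation-passing translation -/

open CCV.Tm (liftS)

namespace Expr

/-- Decision whether an expression is a value. -/
def isVal : {s : Kind} → Expr s → Bool
  | _, var _ => true
  | _, lam _ => true
  | _, _ => false

end Expr

namespace Tm

/-- The argument of an application. -/
def arg : Tm → Tm
  | app _ s => s
  | t => t

/-- A `β`-redex with contractum `t`. -/
def tick (t : Tm) : Tm := app (lam (var 0)) t

end Tm

open CCV.Expr (liftSubst shiftVar shiftCont shiftVarUnder)

/-- The translation `{M}K` of a term `M` with continuation `K`, where `σ` and `δ` interpret the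
ordinary variables and the continuation variables; the translation of a jump ignores `K`.

Apart from the application of a value to a value, an application is translated as the
let-expression to which it reduces, preceded by a Tm.tick. A term `μk.J` keeps its continuation as
garbage. Functions take the continuation before the argument. The value denoted by a value `V` is
the argument in `{V}K`. -/
def tr : {s : Kind} → Expr s → (ℕ → Tm) → (ℕ → Tm) → Tm → Tm
  | _, .var x, σ, _, K => .app K (σ x)
  | _, .lam M, σ, δ, K =>
      .app K (.lam (.lam (tr M (scons (.var 0) fun n => (σ n).shift.shift)
        (fun n => (δ n).shift.shift) (.var 1))))
  | _, .app M N, σ, δ, K =>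
      if M.isVal then
        if N.isVal then tr N σ δ (.app (tr M σ δ K).arg K)
        else Tm.tick (tr N σ δ (.lam (.app (.app (tr M σ δ K).arg.shift K.shift) (.var 0))))
      else
        Tm.tick (tr M σ δ (.lam
          (if N.isVal then
            tr N (fun n => (σ n).shift) (fun n => (δ n).shift) (.app (.var 0) K.shift)
          else
            Tm.tick (tr N (fun n => (σ n).shift) (fun n => (δ n).shift)
              (.lam (.app (.app (.var 1) K.shift.shift) (.var 0)))))))
  | _, .letIn M N, σ, δ, K =>
      tr N σ δ (.lam (tr M (liftS σ) (fun n => (δ n).shift) K.shift))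
  | _, .mu J, σ, δ, K => .mem (tr J σ (scons K δ) K) K
  | _, .jmp k M, σ, δ, _ => tr M σ δ (δ k)

/-- The term denoted by a value. -/
def trVal (V : Expr .term) (σ δ : ℕ → Tm) : Tm := (tr V σ δ (.var 0)).arg

/-- The translation of an application of a value, which is interpreted by `v`, to `N`. -/
def trApp (v : Tm) (N : Expr .term) (σ δ : ℕ → Tm) (K : Tm) : Tm :=
  if N.isVal then tr N σ δ (.app v K)
  else Tm.tick (tr N σ δ (.lam (.app (.app v.shift K.shift) (.var 0))))

theorem tr_of_isVal {V : Expr .term} (hV : V.isVal) (σ δ : ℕ → Tm) (K : Tm) :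
    tr V σ δ K = .app K (trVal V σ δ) := by
  cases V <;> first | rfl | cases hV

theorem arg_tr {V : Expr .term} (hV : V.isVal) (σ δ : ℕ → Tm) (K : Tm) :
    (tr V σ δ K).arg = trVal V σ δ := by
  rw [tr_of_isVal hV]; rfl

theorem tr_app_of_isVal {M : Expr .term} (hM : M.isVal) (N : Expr .term) (σ δ : ℕ → Tm) (K : Tm) :
    tr (.app M N) σ δ K = trApp (trVal M σ δ) N σ δ K := by
  rw [tr, if_pos hM, arg_tr hM]; rfl

theorem tr_app_of_not_isVal {M : Expr .term} (hM : ¬ M.isVal) (N : Expr .term) (σ δ : ℕ → Tm)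
    (K : Tm) :
    tr (.app M N) σ δ K =
      Tm.tick (tr M σ δ (.lam (trApp (.var 0) N (fun n => (σ n).shift) (fun n => (δ n).shift)
        K.shift))) := by
  rw [tr, if_neg hM]; rfl

theorem tr_jump (J : Expr .jump) (σ δ : ℕ → Tm) (K K' : Tm) : tr J σ δ K = tr J σ δ K' := by
  suffices H : ∀ (s : Kind) (J : Expr s), s = .jump → ∀ σ δ K K', tr J σ δ K = tr J σ δ K' from
    H _ J rfl _ _ _ _
  intro s J
  induction J with
  | var | lam | app | mu => intro h; cases h
  | letIn M N ihM => intro h σ δ K K'; rw [tr, tr, ihM h]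
  | jmp k M => intro _ σ δ K K'; rfl

theorem shift_shift_subst (t : Tm) (τ : ℕ → Tm) :
    t.shift.shift.subst (liftS (liftS τ)) = (t.subst τ).shift.shift := by
  rw [Tm.subst_shift, Tm.subst_shift]

theorem arg_subst_of_isVal {V : Expr .term} (hV : V.isVal) (σ δ τ : ℕ → Tm) (K : Tm) :
    (tr V σ δ K).arg.subst τ = ((tr V σ δ K).subst τ).arg := by
  rw [tr_of_isVal hV]; rfl

theorem scons_subst (a : Tm) (f τ : ℕ → Tm) :
    (fun n => (scons a f n).subst τ) = scons (a.subst τ) fun n => (f n).subst τ :=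
  comp_scons (fun t => t.subst τ) a f

theorem tr_subst {s : Kind} (M : Expr s) (σ δ : ℕ → Tm) (K : Tm) (τ : ℕ → Tm) :
    (tr M σ δ K).subst τ =
      tr M (fun n => (σ n).subst τ) (fun n => (δ n).subst τ) (K.subst τ) := by
  induction M generalizing σ δ K τ with
  | var x => rfl
  | lam M ih =>
    simp only [tr, Tm.subst, ih, scons_subst, shift_shift_subst]
    rfl
  | app M N ihM ihN =>
    by_cases hM : M.isVal
    · by_cases hN : N.isVal
      · simp only [tr, if_pos hM, if_pos hN, ihN, Tm.subst, arg_subst_of_isVal hM, ihM]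
      · simp only [tr, if_pos hM, if_neg hN, Tm.tick, ihN, Tm.subst, arg_subst_of_isVal hM, ihM,
          Tm.subst_shift]
        rfl
    · by_cases hN : N.isVal
      · simp only [tr, if_neg hM, if_pos hN, Tm.tick, ihN, ihM, Tm.subst, Tm.subst_shift]
        rfl
      · simp only [tr, if_neg hM, if_neg hN, Tm.tick, ihN, ihM, Tm.subst, Tm.subst_shift]
        rfl
  | letIn M N ihM ihN =>
    simp only [tr, ihM, ihN, Tm.subst, Tm.subst_shift, Tm.subst_comp_liftS]
  | mu J ih => simp only [tr, ih, Tm.subst, scons_subst]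
  | jmp k M ih => simp only [tr, ih]

theorem trVal_subst {V : Expr .term} (hV : V.isVal) (σ δ τ : ℕ → Tm) :
    (trVal V σ δ).subst τ = trVal V (fun n => (σ n).subst τ) (fun n => (δ n).subst τ) := by
  rw [trVal, arg_subst_of_isVal hV, tr_subst, arg_tr hV]

theorem trApp_subst (v : Tm) (N : Expr .term) (σ δ : ℕ → Tm) (K : Tm) (τ : ℕ → Tm) :
    (trApp v N σ δ K).subst τ =
      trApp (v.subst τ) N (fun n => (σ n).subst τ) (fun n => (δ n).subst τ) (K.subst τ) := by
  unfold trApp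
  split
  · simp only [tr_subst, Tm.subst]
  · simp only [Tm.tick, tr_subst, Tm.subst, Tm.subst_shift]; rfl

theorem trVal_shift {V : Expr .term} (hV : V.isVal) (σ δ : ℕ → Tm) :
    (trVal V σ δ).shift = trVal V (fun n => (σ n).shift) (fun n => (δ n).shift) := by
  simp only [Tm.shift, Tm.rename_eq_subst, trVal_subst hV]

@[simp] theorem Expr.isVal_rename {s : Kind} (M : Expr s) (f g : ℕ → ℕ) :
    (M.rename f g).isVal = M.isVal := by
  cases M <;> rfl

theorem tr_rename {s : Kind} (M : Expr s) (f g : ℕ → ℕ) (σ δ : ℕ → Tm) (K : Tm) :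
    tr (M.rename f g) σ δ K = tr M (fun n => σ (f n)) (fun n => δ (g n)) K := by
  induction M generalizing f g σ δ K with
  | var x => rfl
  | lam M ih => simp only [Expr.rename, tr, ih, scons_comp_liftRen]
  | app M N ihM ihN => simp only [Expr.rename, tr, ihM, ihN, Expr.isVal_rename]
  | letIn M N ihM ihN => simp only [Expr.rename, tr, ihM, ihN, Tm.liftS_comp_liftRen]
  | mu J ih => simp only [Expr.rename, tr, ih, scons_comp_liftRen]
  | jmp k M ih => simp only [Expr.rename, tr, ih]

theorem trVal_rename (V : Expr .term) (f g : ℕ → ℕ) (σ δ : ℕ → Tm) :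
    trVal (V.rename f g) σ δ = trVal V (fun n => σ (f n)) (fun n => δ (g n)) := by
  rw [trVal, tr_rename, trVal]

theorem trApp_rename (v : Tm) (N : Expr .term) (f g : ℕ → ℕ) (σ δ : ℕ → Tm) (K : Tm) :
    trApp v (N.rename f g) σ δ K = trApp v N (fun n => σ (f n)) (fun n => δ (g n)) K := by
  simp only [trApp, tr_rename, Expr.isVal_rename]

theorem Expr.isVal_subst {s : Kind} (M : Expr s) {υ : ℕ → Expr .term} (hυ : ∀ n, (υ n).isVal) :
    (M.subst υ).isVal = M.isVal := by
  cases M with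
  | var x => exact hυ x
  | _ => rfl

theorem Expr.isVal_liftSubst {υ : ℕ → Expr .term} (hυ : ∀ n, (υ n).isVal) (n : ℕ) :
    (liftSubst υ n).isVal := by
  cases n with
  | zero => rfl
  | succ n => rw [liftSubst, shiftVar, Expr.isVal_rename]; exact hυ n

/-- Substitution of values in a term amounts to a change of the interpretation of its variables. -/
theorem tr_substExpr {s : Kind} (M : Expr s) (υ : ℕ → Expr .term) (hυ : ∀ n, (υ n).isVal)
    (σ δ : ℕ → Tm) (K : Tm) :
    tr (M.subst υ) σ δ K = tr M (fun n => trVal (υ n) σ δ) δ K := by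
  induction M generalizing υ σ δ K with
  | var x => exact tr_of_isVal (hυ x) _ _ _
  | lam M ih =>
    simp only [Expr.subst, tr, ih _ (Expr.isVal_liftSubst hυ)]
    congr 4
    funext n
    cases n with
    | zero => rfl
    | succ n => simp only [liftSubst, shiftVar, trVal_rename, trVal_shift (hυ n), scons_succ]; rfl
  | app M N ihM ihN => simp only [Expr.subst, tr, ihM _ hυ, ihN _ hυ, Expr.isVal_subst _ hυ,
      trVal_shift (hυ _)]
  | letIn M N ihM ihN =>
    simp only [Expr.subst, tr, ihM _ (Expr.isVal_liftSubst hυ), ihN _ hυ]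
    congr 3
    funext n
    cases n with
    | zero => rfl
    | succ n => 
      simp only [liftSubst, shiftVar, trVal_rename, liftS, scons_succ, trVal_shift (hυ n)]; rfl
  | mu J ih =>
    have h : ∀ n, ((υ n).shiftCont).isVal := fun n => by
      rw [shiftCont, Expr.isVal_rename]; exact hυ n
    simp only [Expr.subst, tr, ih _ h]
    simp only [shiftCont, trVal_rename, id, scons_succ]
  | jmp k M ih => simp only [Expr.subst, tr, ih _ hυ]

theorem Expr.isVal_ctxSubst {s : Kind} (M : Expr s) (k : ℕ) (L : Expr .term) :
    (M.ctxSubst k L).isVal = M.isVal := by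
  cases M with
  | jmp l M => rw [ctxSubst]; split <;> rfl
  | _ => rfl

/-- The continuation `λx.{M}K` for the argument of a let-expression with body `M`. -/
def frame {s : Kind} (M : Expr s) (σ δ : ℕ → Tm) (K : Tm) : Tm :=
  .lam (tr M (liftS σ) (fun n => (δ n).shift) K.shift)

theorem tr_letIn {s : Kind} (M : Expr s) (N : Expr .term) (σ δ : ℕ → Tm) (K : Tm) :
    tr (.letIn M N) σ δ K = tr N σ δ (frame M σ δ K) := rfl

theorem frame_shift {s : Kind} (M : Expr s) (σ δ : ℕ → Tm) (K : Tm) :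
    (frame M σ δ K).shift = frame M (fun n => (σ n).shift) (fun n => (δ n).shift) K.shift := by
  rw [Tm.shift, Tm.rename_eq_subst, frame, Tm.subst, tr_subst]
  simp only [Tm.subst_comp_liftS, Tm.subst_shift]
  simp only [← Tm.rename_eq_subst]
  rfl

theorem frame_shiftVarUnder {s : Kind} (M : Expr s) (a : Tm) (σ δ : ℕ → Tm) (K : Tm) :
    frame M.shiftVarUnder (scons a σ) δ K = frame M σ δ K := by
  simp only [frame, shiftVarUnder, tr_rename, Tm.liftS_comp_liftRen]; rfl

theorem frame_shiftCont {s : Kind} (M : Expr s) (a : Tm) (σ δ : ℕ → Tm) (K : Tm) :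
    frame M.shiftCont σ (scons a δ) K = frame M σ δ K := by
  simp only [frame, shiftCont, tr_rename]; rfl

theorem update_shift (δ : ℕ → Tm) (k : ℕ) (a : Tm) :
    (fun n => (Function.update δ k a n).shift) =
      Function.update (fun n => (δ n).shift) k a.shift := by
  funext n
  by_cases h : n = k
  · subst h; simp only [Function.update_self]
  · simp only [Function.update_of_ne h]

theorem scons_update {α : Type*} (a : α) (δ : ℕ → α) (k : ℕ) (b : α) :
    scons a (Function.update δ k b) = Function.update (scons a δ) (k + 1) b := by
  funext n
  cases n with
  | zero => rfl
  | succ n =>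
    by_cases h : n = k
    · subst h; simp only [scons_succ, Function.update_self]
    · simp only [scons_succ, Function.update_of_ne h,
        Function.update_of_ne (fun h' => h (Nat.succ.inj h'))]

/-- A context substitution amounts to a change of the interpretation of a continuation variable. -/
theorem tr_ctxSubst {s : Kind} (P : Expr s) (k : ℕ) (M : Expr .term) (σ δ : ℕ → Tm) (K : Tm) :
    tr (P.ctxSubst k M) σ δ K = tr P σ (Function.update δ k (frame M σ δ (δ k))) K := by
  induction P generalizing k M σ δ K with
  | var x => rfl
  | lam P ih =>
    have h : (fun n => (Function.update δ k (frame M σ δ (δ k)) n).shift.shift) =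
        Function.update (fun n => (δ n).shift.shift) k
          (frame M σ δ (δ k)).shift.shift := by
      rw [← update_shift, ← update_shift]
    simp only [Expr.ctxSubst, tr, ih, frame_shiftVarUnder, h, frame_shift]
  | app P Q ihP ihQ =>
    simp only [Expr.ctxSubst, tr, ihP, ihQ, Expr.isVal_ctxSubst, update_shift, frame_shift]
  | letIn P Q ihP ihQ =>
    simp only [Expr.ctxSubst, tr, liftS, ihP, ihQ, frame_shiftVarUnder, update_shift, frame_shift]
  | mu J ih =>
    simp only [Expr.ctxSubst, tr, ih, frame_shiftCont, scons_update, scons_succ]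
  | jmp l P ih =>
    rw [Expr.ctxSubst]
    split_ifs with h
    · subst h
      simp only [tr, ih, Function.update_self]
      rfl
    · simp only [tr, ih, Function.update_of_ne h]

theorem Expr.Eqv.isVal_eq {s : Kind} {M M' : Expr s} (h : Eqv M M') : M.isVal = M'.isVal := by
  induction h with
  | symm _ ih => exact ih.symm
  | trans _ _ ih ih' => exact ih.trans ih'
  | _ => rfl

/-- The translation respects the syntactic equality. -/
theorem Expr.Eqv.tr_eq {s : Kind} {M M' : Expr s} (h : Eqv M M') (σ δ : ℕ → Tm) (K : Tm) :
    tr M σ δ K = tr M' σ δ K := by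
  induction h generalizing σ δ K with
  | assoc L M N =>
    change tr N σ δ (frame M σ δ (frame L σ δ K)) = tr N σ δ (Tm.lam (tr M (liftS σ) _
      (frame L.shiftVarUnder (liftS σ) (fun n => (δ n).shift) K.shift)))
    rw [liftS, frame_shiftVarUnder, ← frame_shift]
    rfl
  | jmpLet k L M => simp only [tr]
  | refl M => rfl
  | symm _ ih => exact (ih _ _ _).symm
  | trans _ _ ih ih' => exact (ih _ _ _).trans (ih' _ _ _)
  | lam _ ih => simp only [tr, ih]
  | app h h' ih ih' => simp only [tr, ih, ih', h.isVal_eq, h'.isVal_eq]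
  | letIn _ _ ih ih' => simp only [tr, ih, ih']
  | mu _ ih => simp only [tr, ih]
  | jmp k _ ih => simp only [tr, ih]

/-! ### Simulation of reduction steps -/

namespace Tm

/-- Reduction in any number of steps. -/
abbrev Reds : Tm → Tm → Prop := Relation.ReflTransGen Red

/-- Reduction in at least one step. -/
abbrev Redp : Tm → Tm → Prop := Relation.TransGen Red

theorem Reds.lam {t t' : Tm} (h : Reds t t') : Reds (lam t) (lam t') :=
  Relation.ReflTransGen.lift _ (fun _ _ h => Red.lam h) _ _ h

theorem Reds.appLeft {t t' : Tm} (s : Tm) (h : Reds t t') : Reds (app t s) (app t' s) :=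
  Relation.ReflTransGen.lift (fun t => app t s) (fun _ _ h => Red.appLeft s h) _ _ h

theorem Reds.appRight (s : Tm) {t t' : Tm} (h : Reds t t') : Reds (app s t) (app s t') :=
  Relation.ReflTransGen.lift (app s) (fun _ _ h => Red.appRight s h) _ _ h

theorem Reds.memLeft {t t' : Tm} (s : Tm) (h : Reds t t') : Reds (mem t s) (mem t' s) :=
  Relation.ReflTransGen.lift (fun t => mem t s) (fun _ _ h => Red.memLeft s h) _ _ h

theorem Reds.memRight (s : Tm) {t t' : Tm} (h : Reds t t') : Reds (mem s t) (mem s t') :=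
  Relation.ReflTransGen.lift (mem s) (fun _ _ h => Red.memRight s h) _ _ h

theorem Reds.tick {t t' : Tm} (h : Reds t t') : Reds (tick t) (tick t') := h.appRight _

theorem Reds.shift {t t' : Tm} (h : Reds t t') : Reds t.shift t'.shift :=
  Relation.ReflTransGen.lift _ (fun _ _ h => Red.shift h) _ _ h

theorem Redp.lam {t t' : Tm} (h : Redp t t') : Redp (lam t) (lam t') :=
  Relation.TransGen.lift _ (fun _ _ h => Red.lam h) _ _ h

theorem Redp.appLeft {t t' : Tm} (s : Tm) (h : Redp t t') : Redp (app t s) (app t' s) :=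
  Relation.TransGen.lift (fun t => app t s) (fun _ _ h => Red.appLeft s h) _ _ h

theorem Redp.appRight (s : Tm) {t t' : Tm} (h : Redp t t') : Redp (app s t) (app s t') :=
  Relation.TransGen.lift (app s) (fun _ _ h => Red.appRight s h) _ _ h

theorem Redp.memLeft {t t' : Tm} (s : Tm) (h : Redp t t') : Redp (mem t s) (mem t' s) :=
  Relation.TransGen.lift (fun t => mem t s) (fun _ _ h => Red.memLeft s h) _ _ h

theorem Redp.memRight (s : Tm) {t t' : Tm} (h : Redp t t') : Redp (mem s t) (mem s t') :=
  Relation.TransGen.lift (mem s) (fun _ _ h => Red.memRight s h) _ _ h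

theorem Redp.tick {t t' : Tm} (h : Redp t t') : Redp (tick t) (tick t') := h.appRight _

theorem Redp.shift {t t' : Tm} (h : Redp t t') : Redp t.shift t'.shift :=
  Relation.TransGen.lift _ (fun _ _ h => Red.shift h) _ _ h

theorem red_tick (t : Tm) : Red (tick t) t := Red.beta (var 0) t

end Tm

open CCV.Tm (Red Reds Redp)

/-- The translation is monotone in the continuations and in the interpretation of continuation
variables. -/
theorem tr_reds {s : Kind} (M : Expr s) {σ δ δ' : ℕ → Tm} {K K' : Tm}
    (hδ : ∀ n, Reds (δ n) (δ' n)) (hK : Reds K K') :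
    Reds (tr M σ δ K) (tr M σ δ' K') ∧ (M.isVal → Reds (tr M σ δ K).arg (tr M σ δ' K').arg) := by
  induction M generalizing σ δ δ' K K' with
  | var x => exact ⟨hK.appLeft _, fun _ => .refl⟩
  | lam M ih =>
    have h := ((ih (σ := scons (.var 0) fun n => (σ n).shift.shift)
      (fun n => (hδ n).shift.shift) (.refl (a := .var 1))).1.lam).lam
    exact ⟨(hK.appLeft _).trans (h.appRight _), fun _ => h⟩
  | app M N ihM ihN =>
    refine ⟨?_, by simp [Expr.isVal]⟩
    by_cases hM : M.isVal <;> by_cases hN : N.isVal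
    · simp only [tr, if_pos hM, if_pos hN]
      exact (ihN hδ (((ihM hδ hK).2 hM).appLeft _ |>.trans (hK.appRight _))).1
    · simp only [tr, if_pos hM, if_neg hN]
      have h := (((ihM (σ := σ) hδ hK).2 hM).shift.appLeft K.shift).trans (hK.shift.appRight _)
      exact (ihN hδ (Reds.appLeft _ h).lam).1.tick
    · simp only [tr, if_neg hM, if_pos hN]
      exact (ihM hδ (ihN (fun n => (hδ n).shift) (hK.shift.appRight _)).1.lam).1.tick
    · simp only [tr, if_neg hM, if_neg hN]
      exact (ihM hδ (ihN (fun n => (hδ n).shift)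
        ((hK.shift.shift.appRight _).appLeft _).lam).1.tick.lam).1.tick
  | letIn M N ihM ihN =>
    exact ⟨(ihN hδ (ihM (fun n => (hδ n).shift) hK.shift).1.lam).1, by simp [Expr.isVal]⟩
  | mu J ih =>
    refine ⟨?_, by simp [Expr.isVal]⟩
    refine (((ih (δ' := scons K' δ') ?_ hK).1).memLeft _).trans (hK.memRight _)
    intro n
    cases n with
    | zero => exact hK
    | succ n => exact hδ n
  | jmp k M ih => exact ⟨(ih hδ (hδ k)).1, by simp [Expr.isVal]⟩

theorem tr_reds_cont {s : Kind} (M : Expr s) {σ δ : ℕ → Tm} {K K' : Tm} (hK : Reds K K') :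
    Reds (tr M σ δ K) (tr M σ δ K') := (tr_reds M (fun _ => .refl) hK).1

/-- A reduction of the continuation of a term is never lost. -/
theorem tr_redp (M : Expr .term) {σ δ : ℕ → Tm} {K K' : Tm} (hK : Redp K K') :
    Redp (tr M σ δ K) (tr M σ δ K') := by
  suffices H : ∀ (s : Kind) (M : Expr s), s = .term → ∀ {σ δ : ℕ → Tm} {K K' : Tm}, Redp K K' →
      Redp (tr M σ δ K) (tr M σ δ K') from H _ M rfl hK
  clear! M σ δ K K'
  intro s M
  induction M with
  | var x => intro _ _ _ _ _ hK; exact hK.appLeft _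
  | lam M ih => intro _ _ _ _ _ hK; exact hK.appLeft _
  | app M N ihM ihN =>
    intro _ σ δ K K' hK
    by_cases hM : M.isVal
    · simp only [tr_app_of_isVal hM, trApp]
      split
      · exact ihN rfl (hK.appRight _)
      · exact (ihN rfl ((hK.shift.appRight _).appLeft _).lam).tick
    · simp only [tr_app_of_not_isVal hM]
      refine (ihM rfl (Redp.lam ?_)).tick
      simp only [trApp]
      split
      · exact ihN rfl (hK.shift.appRight _)
      · exact (ihN rfl ((hK.shift.shift.appRight _).appLeft _).lam).tick
  | letIn M N ihM ihN =>
    intro hs σ δ K K' hK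
    exact ihN rfl (ihM hs hK.shift).lam
  | mu J ih =>
    intro _ σ δ K K' hK
    have h : Reds (tr J σ (scons K δ) K) (tr J σ (scons K' δ) K') := by
      refine (tr_reds J ?_ hK.to_reflTransGen).1
      intro n
      cases n with
      | zero => exact hK.to_reflTransGen
      | succ n => exact .refl
    exact .trans_right (h.memLeft _) (hK.memRight _)
  | jmp k M ih => intro h; cases h

theorem trApp_redp (N : Expr .term) {σ δ : ℕ → Tm} {v v' K : Tm} (hv : Redp v v') :
    Redp (trApp v N σ δ K) (trApp v' N σ δ K) := by
  unfold trApp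
  split
  · exact tr_redp _ (hv.appLeft _)
  · exact (tr_redp _ ((hv.shift.appLeft _).appLeft _).lam).tick

theorem trApp_float (N : Expr .term) {σ δ : ℕ → Tm} (v a g : Tm)
    (hN : ∀ {σ δ : ℕ → Tm} (a g : Tm), Reds (tr N σ δ (.mem a g)) (.mem (tr N σ δ a) g)) :
    Reds (trApp v N σ δ (.mem a g)) (.mem (trApp v N σ δ a) g) := by
  unfold trApp
  split
  · exact (tr_reds_cont N (.single (.floatArg _ _ _))).trans (hN _ _)
  · refine .trans (Reds.tick ?_) (.single (.floatArg _ _ _))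
    refine (tr_reds_cont N ?_).trans (hN _ _)
    refine .trans (Reds.lam ?_) (.single (.floatLam _ _))
    exact .trans (.single (.appLeft _ (.floatArg _ _ _))) (.single (.floatFun _ _ _))

/-- Garbage of the continuation moves to the root. This simulates the exchange of a let-expression
and a `μ`-abstraction, because `{μk.J}K` carries the garbage `K`. -/
theorem tr_float (M : Expr .term) {σ δ : ℕ → Tm} (a g : Tm) :
    Reds (tr M σ δ (.mem a g)) (.mem (tr M σ δ a) g) := by
  suffices H : ∀ (s : Kind) (M : Expr s), s = .term → ∀ {σ δ : ℕ → Tm} (a g : Tm),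
      Reds (tr M σ δ (.mem a g)) (.mem (tr M σ δ a) g) from H _ M rfl a g
  clear! M σ δ a g
  intro s M
  induction M with
  | var x => intro _ _ _ _ _; exact .single (.floatFun _ _ _)
  | lam M ih => intro _ _ _ _ _; exact .single (.floatFun _ _ _)
  | app M N ihM ihN =>
    intro _ σ δ a g
    by_cases hM : M.isVal
    · simp only [tr_app_of_isVal hM]
      exact trApp_float N _ _ _ (ihN rfl)
    · simp only [tr_app_of_not_isVal hM]
      refine .trans (Reds.tick ?_) (.single (.floatArg _ _ _))
      refine (tr_reds_cont M ?_).trans (ihM rfl _ _)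
      exact .trans (trApp_float N _ _ _ (ihN rfl)).lam (.single (.floatLam _ _))
  | letIn M N ihM ihN =>
    intro hs σ δ a g
    refine (tr_reds_cont N ?_).trans (ihN rfl _ _)
    exact (ihM hs _ _).lam.trans (.single (.floatLam _ _))
  | mu J ih =>
    intro _ σ δ a g
    have h : Reds (tr J σ (scons (.mem a g) δ) (.mem a g)) (tr J σ (scons a δ) a) := by
      refine (tr_reds J ?_ (.single (.drop _ _))).1
      intro n
      cases n with
      | zero => exact .single (.drop _ _)
      | succ n => exact .refl
    exact (h.memLeft _).trans (.single (.floatMem _ _ _))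
  | jmp k M ih => intro h; cases h

/-- The continuation is a subterm of the translation of a term. Hence the garbage `λx.{M}K` of the
translation of `M⟨x := μk.J⟩` can be replaced by `K`, the garbage of its reduct. -/
theorem sub_tr (M : Expr .term) (σ δ : ℕ → Tm) (K : Tm) : Tm.Sub (tr M σ δ K) K := by
  suffices H : ∀ (s : Kind) (M : Expr s), s = .term → ∀ (σ δ : ℕ → Tm) (K : Tm),
      Tm.Sub (tr M σ δ K) K from H _ M rfl _ _ _
  clear! M σ δ K
  intro s M
  induction M with
  | var x => intro _ _ _ _; exact .appLeft _ (.refl _)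
  | lam M ih => intro _ _ _ _; exact .appLeft _ (.refl _)
  | app M N ihM ihN =>
    have h (v : Tm) (σ δ : ℕ → Tm) (K : Tm) : Tm.Sub (trApp v N σ δ K) K := by
      unfold trApp
      split
      · exact (ihN rfl _ _ _).trans (.appRight _ (.refl _))
      · exact .appRight _ ((ihN rfl _ _ _).trans (.lam (.appLeft _ (.appRight _ (.refl _)))))
    intro _ σ δ K
    by_cases hM : M.isVal
    · rw [tr_app_of_isVal hM]
      exact h _ _ _ _
    · rw [tr_app_of_not_isVal hM]
      exact .appRight _ ((ihM rfl _ _ _).trans (.lam (h _ _ _ _)))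
  | letIn M N ihM ihN =>
    intro hs σ δ K
    exact (ihN rfl _ _ _).trans (.lam (ihM hs _ _ _))
  | mu J ih => intro _ σ δ K; exact .memRight _ (.refl _)
  | jmp k M ih => intro h; cases h

theorem Expr.isVal_iff {M : Expr .term} : M.isVal ↔ Expr.IsValue M := by
  constructor
  · intro h
    cases M with
    | var x => exact .var x
    | lam M => exact .lam M
    | _ => cases h
  · intro h
    cases h <;> rfl

theorem Expr.Step.isVal {s : Kind} {M M' : Expr s} (h : Step M M') (hM : M.isVal) : M'.isVal := by
  cases h with
  | etaLam hV => exact isVal_iff.2 hV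
  | lam => rfl
  | _ => cases hM

theorem tr_inst {s : Kind} (M : Expr s) {V : Expr .term} (hV : V.isVal) (σ δ : ℕ → Tm) (K : Tm) :
    tr (M.inst V) σ δ K = tr M (scons (trVal V σ δ) σ) δ K := by
  rw [Expr.inst, tr_substExpr _ _ (by rintro (_ | n); exacts [hV, rfl])]
  congr 1
  funext n
  cases n <;> rfl

theorem tr_instCont {s : Kind} (J : Expr s) (l : ℕ) (σ δ : ℕ → Tm) (K : Tm) :
    tr (J.instCont l) σ δ K = tr J σ (scons (δ l) δ) K := by
  rw [Expr.instCont, tr_rename]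
  congr 1
  funext n
  cases n <;> rfl

theorem inst_trApp_shift (v : Tm) (N : Expr .term) (σ δ : ℕ → Tm) (K : Tm) :
    (trApp (.var 0) N (fun n => (σ n).shift) (fun n => (δ n).shift) K.shift).inst v =
      trApp v N σ δ K := by
  rw [Tm.inst, trApp_subst]
  simp only [← Tm.inst.eq_def, Tm.shift_inst]
  rfl

theorem tr_inst_frame {s : Kind} (M : Expr s) (v : Tm) (σ δ : ℕ → Tm) (K : Tm) :
    (tr M (liftS σ) (fun n => (δ n).shift) K.shift).inst v = tr M (scons v σ) δ K := by
  rw [Tm.inst, tr_subst]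
  simp only [liftS, scons_subst]
  simp only [← Tm.inst.eq_def, Tm.shift_inst]
  rfl

theorem inst_trVal_lam (M : Expr .term) (σ δ : ℕ → Tm) (K : Tm) :
    Tm.inst (.lam (tr M (scons (.var 0) fun n => (σ n).shift.shift)
      (fun n => (δ n).shift.shift) (.var 1))) K = frame M σ δ K := by
  rw [frame, Tm.inst, Tm.subst, tr_subst]
  simp only [scons_subst, Tm.subst_shift]
  simp only [← Tm.inst.eq_def, Tm.shift_inst]
  rfl

/-- When the function part of an application becomes a value, the tick and the `β`-redex formed by
that value and its continuation are contracted. -/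
theorem tr_app_redp_of_isVal {M : Expr .term} (hM : ¬ M.isVal) {V : Expr .term} (hV : V.isVal)
    (N : Expr .term) {σ δ : ℕ → Tm} {K : Tm} (h : ∀ K, Redp (tr M σ δ K) (tr V σ δ K)) :
    Redp (tr (.app M N) σ δ K) (tr (.app V N) σ δ K) := by
  rw [tr_app_of_not_isVal hM, tr_app_of_isVal hV]
  refine .trans (h _).tick (.trans (.single (Tm.red_tick _)) ?_)
  rw [tr_of_isVal hV, ← inst_trApp_shift (trVal V σ δ)]
  exact .single (.beta _ _)

/-- When the argument of a value becomes a value itself, the tick and the `β`-redex formed by the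
argument and its continuation are contracted. -/
theorem trApp_redp_arg (v : Tm) {N N' : Expr .term} (hv : N.isVal → N'.isVal) {σ δ : ℕ → Tm}
    {K : Tm} (h : ∀ K, Redp (tr N σ δ K) (tr N' σ δ K)) :
    Redp (trApp v N σ δ K) (trApp v N' σ δ K) := by
  unfold trApp
  by_cases hN : N.isVal
  · rw [if_pos hN, if_pos (hv hN)]
    exact h _
  · rw [if_neg hN]
    split
    · rename_i hN'
      refine .trans (h _).tick (.trans (.single (Tm.red_tick _)) ?_)
      rw [tr_of_isVal hN', tr_of_isVal hN']
      have hb := Red.beta (.app (.app v.shift K.shift) (.var 0)) (trVal N' σ δ)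
      have he : (Tm.app (.app v.shift K.shift) (.var 0)).inst (trVal N' σ δ) =
          .app (.app (v.shift.inst (trVal N' σ δ)) (K.shift.inst (trVal N' σ δ)))
            (trVal N' σ δ) := rfl
      rw [he, Tm.shift_inst, Tm.shift_inst] at hb
      exact .single hb
    · exact (h _).tick

/-- Every reduction step of expressions is simulated by at least one step of their translations.
For values, the same holds for the terms that they denote. -/
theorem Expr.Step.redp {s : Kind} {M M' : Expr s} (h : Step M M') :
    ∀ (σ δ : ℕ → Tm) (K : Tm), Redp (tr M σ δ K) (tr M' σ δ K) ∧
      (M.isVal → Redp (tr M σ δ K).arg (tr M' σ δ K).arg) := by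
  induction h with
  | @ad₁ N M hN =>
    refine fun σ δ K => ⟨?_, by simp [Expr.isVal]⟩
    rw [tr_app_of_not_isVal (isVal_iff.not.2 hN), tr, tr_app_of_isVal (by rfl), shiftVar,
      trApp_rename]
    exact .single (Tm.red_tick _)
  | @ad₂ V N hV hN =>
    refine fun σ δ K => ⟨?_, by simp [Expr.isVal]⟩
    have hV := isVal_iff.2 hV
    rw [tr_app_of_isVal hV, tr, tr_app_of_isVal (by rw [shiftVar, isVal_rename, hV]), shiftVar,
      trVal_rename, trApp, if_neg (isVal_iff.not.2 hN), trApp, if_pos (by rfl), trVal_shift hV]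
    exact .single (Tm.red_tick _)
  | @betaLam M V hV =>
    refine fun σ δ K => ⟨?_, by simp [Expr.isVal]⟩
    have hV := isVal_iff.2 hV
    rw [tr_app_of_isVal (by rfl), trApp, if_pos hV, tr_letIn]
    refine tr_redp _ (.single ?_)
    rw [← inst_trVal_lam]
    exact .beta _ _
  | @betaLet M V hV =>
    refine fun σ δ K => ⟨?_, by simp [Expr.isVal]⟩
    have hV := isVal_iff.2 hV
    rw [tr_letIn, tr_of_isVal hV, tr_inst _ hV, ← tr_inst_frame]
    exact .single (.beta _ _)
  | betaMu M J =>
    refine fun σ δ K => ⟨?_, by simp [Expr.isVal]⟩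
    rw [tr_letIn, tr, tr, tr_ctxSubst, scons_zero, frame_shiftCont]
    have he : Function.update (scons K δ) 0 (frame M σ δ K) = scons (frame M σ δ K) δ := by
      funext n; cases n <;> rfl
    rw [he, tr_jump _ _ _ _ K]
    exact .single (.extract _ (.lam (sub_tr _ _ _ _)))
  | betaJmp l J =>
    refine fun σ δ K => ⟨?_, by simp [Expr.isVal]⟩
    rw [tr, tr, tr_instCont, tr_jump _ _ _ _ K]
    exact .single (.drop _ _)
  | @etaLam V hV =>
    intro σ δ K
    have hV := isVal_iff.2 hV
    have h : Redp (trVal (.lam (.app V.shiftVar (.var 0))) σ δ) (trVal V σ δ) := by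
      change Redp (Tm.lam (.lam (tr _ _ _ _))) _
      rw [tr_app_of_isVal (by rw [shiftVar, isVal_rename, hV]), shiftVar, trVal_rename, trApp,
        if_pos (by rfl)]
      simp only [scons_comp_succ, id]
      rw [← trVal_shift hV, ← trVal_shift hV]
      exact .trans (.single (.lam (.eta (.app _ (.var 0))))) (.single (.eta _))
    rw [tr_of_isVal (by rfl), tr_of_isVal hV]
    exact ⟨h.appRight _, fun _ => h⟩
  | etaLet M =>
    exact fun σ δ K => ⟨tr_redp _ (.single (.eta K)), by simp [Expr.isVal]⟩
  | etaMu M =>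
    refine fun σ δ K => ⟨?_, by simp [Expr.isVal]⟩
    rw [tr, tr, shiftCont, tr_rename]
    exact .single (.drop _ _)
  | exch J M =>
    refine fun σ δ K => ⟨?_, by simp [Expr.isVal]⟩
    rw [tr_letIn, tr, tr_letIn, shiftCont, tr_rename]
    refine .trans_left (tr_redp M (.single (.floatLam _ _))) (.trans (tr_float _ _ _) ?_)
    have he : scons K.shift (fun n => (δ n).shift) = fun n => (scons K δ n).shift := by
      funext n; cases n <;> rfl
    rw [he]
    exact .refl
  | lam _ ih =>
    intro σ δ K
    have h := (((ih (scons (.var 0) fun n => (σ n).shift.shift)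
      (fun n => (δ n).shift.shift) (.var 1)).1).lam).lam
    exact ⟨h.appRight _, fun _ => h⟩
  | @appLeft M M' N hs ih =>
    refine fun σ δ K => ⟨?_, by simp [Expr.isVal]⟩
    by_cases hM : M.isVal
    · rw [tr_app_of_isVal hM, tr_app_of_isVal (hs.isVal hM)]
      exact trApp_redp _ ((ih σ δ (.var 0)).2 hM)
    · by_cases hM' : M'.isVal
      · exact tr_app_redp_of_isVal hM hM' _ fun K => (ih σ δ K).1
      · rw [tr_app_of_not_isVal hM, tr_app_of_not_isVal hM']
        exact (ih _ _ _).1.tick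
  | @appRight M N N' hs ih =>
    refine fun σ δ K => ⟨?_, by simp [Expr.isVal]⟩
    by_cases hM : M.isVal
    · rw [tr_app_of_isVal hM, tr_app_of_isVal hM]
      exact trApp_redp_arg _ hs.isVal fun K => (ih _ _ K).1
    · rw [tr_app_of_not_isVal hM, tr_app_of_not_isVal hM]
      exact (tr_redp _ (trApp_redp_arg _ hs.isVal fun K => (ih _ _ K).1).lam).tick
  | letBody N _ ih =>
    exact fun σ δ K => ⟨tr_redp _ (ih _ _ _).1.lam, by simp [Expr.isVal]⟩
  | letArg M _ ih =>
    exact fun σ δ K => ⟨(ih _ _ _).1, by simp [Expr.isVal]⟩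
  | mu _ ih => exact fun σ δ K => ⟨(ih _ _ _).1.memLeft _, by simp [Expr.isVal]⟩
  | jmp k _ ih => exact fun σ δ K => ⟨(ih _ _ _).1, by simp [Expr.isVal]⟩

/-- A term is strongly normalizable if its translation is. -/
theorem Term.stronglyNormalizable_of_tr {M : Expr .term} {σ δ : ℕ → Tm} {K : Tm}
    (h : Tm.SN (tr M σ δ K)) : (Term.mk M).StronglyNormalizable := by
  let φ : Term → Tm := Quotient.lift (fun M => tr M σ δ K) fun _ _ h => Expr.Eqv.tr_eq h σ δ K
  have h' : Acc (Function.swap Tm.Redp) (φ (Term.mk M)) := by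
    refine Subrelation.accessible (fun h => ?_)
      (Acc.transGen (show Acc (Function.swap Tm.Red) (tr M σ δ K) from h))
    exact Relation.transGen_swap.2 h
  refine Subrelation.accessible ?_ (InvImage.accessible φ h')
  rintro _ _ ⟨N, N', rfl, rfl, hs⟩
  exact (hs.redp σ δ K).1

/-! ### Typeable terms are strongly normalizable -/

open CCV.Tm (SN Cand)

section
variable {Atom : Type*}

/-- The interpretation of types by reducibility candidates. Raw types and subsidiary types denote
sets of values, but a type `T` denotes the set of continuations that accept values of type `T`. -/
def interp : {l : Level} → Ty Atom l → Set Tm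
  | _, .atom _ => {t | SN t}
  | _, .arr S T => Tm.arrow (interp T) (Tm.arrow (interp S) {t | SN t})
  | _, .inter _ R => ⋂ i, interp (R i)
  | _, .union _ S => ⋂ i, Tm.arrow (interp (S i)) {t | SN t}

theorem cand_interp {l : Level} (A : Ty Atom l) : Cand (interp A) := by
  induction A with
  | atom α => exact Tm.cand_sn
  | arr S T ihS ihT => exact ihT.arrow (ihS.arrow Tm.cand_sn)
  | inter n R ih => exact Cand.iInter ih
  | union n S ih => exact Cand.iInter fun i => (ih i).arrow Tm.cand_sn

theorem Ty.Le.interp_subset {l : Level} {A B : Ty Atom l} (h : Ty.Le A B) :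
    (l ≠ .typ → interp A ⊆ interp B) ∧ (l = .typ → interp B ⊆ interp A) := by
  induction h with
  | atom α => exact ⟨fun _ => subset_rfl, nofun⟩
  | arr _ _ ihS ihT =>
    exact ⟨fun _ t ht k hk s hs => ht k (ihT.2 rfl hk) s (ihS.1 nofun hs), nofun⟩
  | inter f _ ih =>
    exact ⟨fun _ t ht => Set.mem_iInter.2 fun j => (ih j).1 nofun (Set.mem_iInter.1 ht (f j)),
      nofun⟩
  | union f _ ih =>
    exact ⟨fun h => absurd rfl h, fun _ t ht => Set.mem_iInter.2 fun i s hs =>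
      Set.mem_iInter.1 ht (f i) s ((ih i).1 nofun hs)⟩

/-- The continuations that accept the result of an expression; jumps have no result. -/
def Res.conts : {s : Kind} → Res Atom s → Set Tm
  | _, .ty T => interp T
  | _, .bot => Set.univ

theorem Tm.sn_tick {t : Tm} (h : SN t) : SN (Tm.tick t) :=
  Tm.cand_sn.lam Tm.cand_sn (t := .var 0) (fun _ hs => hs) t h

theorem frame_mem_arrow {s : Kind} {M : Expr s} {σ δ : ℕ → Tm} {K : Tm} {X : Set Tm} (hX : Cand X)
    (h : ∀ v ∈ X, SN (tr M (scons v σ) δ K)) : frame M σ δ K ∈ Tm.arrow X {t | SN t} :=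
  hX.lam Tm.cand_sn fun v hv => by rw [tr_inst_frame]; exact h v hv

theorem sn_trApp {v : Tm} {N : Expr .term} {σ δ : ℕ → Tm} {K : Tm} {m : ℕ}
    {S : Fin (m + 1) → Ty Atom .sub} {T : Ty Atom .typ}
    (hv : v ∈ interp (Ty.inter m fun j => .arr (S j) T)) (hK : K ∈ interp T)
    (hN : ∀ K ∈ interp (Ty.union m S), SN (tr N σ δ K)) : SN (trApp v N σ δ K) := by
  have hv' (j : Fin (m + 1)) : Tm.app v K ∈ Tm.arrow (interp (S j)) {t | SN t} :=
    Set.mem_iInter.1 hv j K hK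
  unfold trApp
  split
  · exact hN _ (Set.mem_iInter.2 hv')
  · refine Tm.sn_tick (hN _ (Set.mem_iInter.2 fun j => ?_))
    refine (cand_interp (S j)).lam Tm.cand_sn fun s hs => ?_
    change Tm.app (.app (v.shift.inst s) (K.shift.inst s)) s ∈ _
    rw [Tm.shift_inst, Tm.shift_inst]
    exact hv' j s hs

/-- The translation of a typed expression is strongly normalizable if its free variables and its
continuation are interpreted by reducible terms. -/
theorem Typing.sn_tr {Γ : List (Ty Atom .sub)} {s : Kind} {M : Expr s} {ρ : Res Atom s}
    {Δ : List (Ty Atom .typ)} (h : Typing Γ M ρ Δ) :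
    ∀ σ δ : ℕ → Tm, (∀ x S, Γ[x]? = some S → σ x ∈ interp S) →
      (∀ k T, Δ[k]? = some T → δ k ∈ interp T) → ∀ K ∈ ρ.conts, SN (tr M σ δ K) := by
  have cons {l : Level} {Γ : List (Ty Atom l)} {σ : ℕ → Tm} {v : Tm} {S : Ty Atom l}
      (hσ : ∀ x S, Γ[x]? = some S → σ x ∈ interp S) (hv : v ∈ interp S) :
      ∀ x S', (S :: Γ)[x]? = some S' → scons v σ x ∈ interp S' := by
    rintro (_ | x) S' hx
    · obtain rfl : S = S' := by simpa using hx
      exact hv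
    · exact hσ x S' (by simpa using hx)
  induction h with
  | var hx =>
    intro σ δ hσ hδ K hK
    exact Set.mem_iInter.1 hK 0 _ (hσ _ _ hx)
  | lam n S T _ ih =>
    intro σ δ hσ hδ K hK
    refine Set.mem_iInter.1 hK 0 _ (Set.mem_iInter.2 fun i => ?_)
    refine (cand_interp (T i)).lam ((cand_interp (S i)).arrow Tm.cand_sn) fun k hk => ?_
    rw [inst_trVal_lam]
    exact frame_mem_arrow (cand_interp (S i)) fun v hv => ih i _ _ (cons hσ hv) hδ k hk
  | @app Γ Δ M N n m S T _ _ ihM ihN =>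
    intro σ δ hσ hδ K hK
    have hB (i : Fin (n + 1)) (v : Tm) (hv : v ∈ interp (Ty.inter (m i) fun j => .arr (S i j) T)) :
        SN (trApp v N σ δ K) := sn_trApp hv hK (ihN i σ δ hσ hδ)
    have h := ihM σ δ hσ hδ (.lam (trApp (.var 0) N (fun n => (σ n).shift) (fun n => (δ n).shift)
      K.shift)) (Set.mem_iInter.2 fun i => (cand_interp _).lam Tm.cand_sn fun v hv => by
        rw [inst_trApp_shift]; exact hB i v hv)
    by_cases hM : M.isVal
    · rw [tr_app_of_isVal hM, ← inst_trApp_shift]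
      rw [tr_of_isVal hM] at h
      exact h.red (.beta _ _)
    · rw [tr_app_of_not_isVal hM]
      exact Tm.sn_tick h
  | letIn n S ρ _ _ ihM ihN =>
    intro σ δ hσ hδ K hK
    exact ihN σ δ hσ hδ _ (Set.mem_iInter.2 fun i =>
      frame_mem_arrow (cand_interp (S i)) fun v hv => ihM i _ _ (cons hσ hv) hδ K hK)
  | @mu Γ Δ J T _ ih =>
    intro σ δ hσ hδ K hK
    exact Tm.cand_sn.mem (ih σ _ hσ (cons hδ hK) K trivial) ((cand_interp T).sn hK)
  | jmp hk _ ih =>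
    intro σ δ hσ hδ K _
    exact ih σ δ hσ hδ _ (hδ _ _ hk)
  | sub _ hle ih =>
    intro σ δ hσ hδ K hK
    exact ih σ δ hσ hδ K (hle.interp_subset.2 rfl hK)
  | eqv _ he ih =>
    intro σ δ hσ hδ K hK
    rw [← he.tr_eq]
    exact ih σ δ hσ hδ K hK

theorem Term.Typeable.stronglyNormalizable {a : Term} (h : a.Typeable Atom) :
    a.StronglyNormalizable := by
  obtain ⟨M, Γ, T, Δ, rfl, h⟩ := h
  exact Term.stronglyNormalizable_of_tr (h.sn_tr Tm.var Tm.var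
    (fun x S _ => (cand_interp S).var x) (fun k T _ => (cand_interp T).var k)
    (.var 0) ((cand_interp T).var 0))

end

/-! ### Intersections, unions and subtyping -/

section
variable {Atom : Type*}

namespace Ty

/-- Membership of a raw type in an intersection. -/
instance : Membership (Ty Atom .raw) (Ty Atom .sub) where
  mem S R := match S with
    | .inter _ R' => ∃ i, R' i = R

/-- Membership of a subsidiary type in a union. -/
instance : Membership (Ty Atom .sub) (Ty Atom .typ) where
  mem T S := match T with
    | .union _ S' => ∃ i, S' i = S

theorem mem_inter {n : ℕ} {R' : Fin (n + 1) → Ty Atom .raw} {R : Ty Atom .raw} :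
    R ∈ Ty.inter n R' ↔ ∃ i, R' i = R := Iff.rfl

theorem mem_union {n : ℕ} {S' : Fin (n + 1) → Ty Atom .sub} {S : Ty Atom .sub} :
    S ∈ Ty.union n S' ↔ ∃ i, S' i = S := Iff.rfl

@[simp] theorem mem_ofSub {S S' : Ty Atom .sub} : S' ∈ Ty.ofSub S ↔ S' = S :=
  ⟨fun ⟨_, h⟩ => h.symm, fun h => ⟨0, h.symm⟩⟩

/-- A raw type regarded as a subsidiary type (a unary intersection). -/
def ofRaw (R : Ty Atom .raw) : Ty Atom .sub := .inter 0 fun _ => R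

@[simp] theorem mem_ofRaw {R R' : Ty Atom .raw} : R' ∈ Ty.ofRaw R ↔ R' = R :=
  ⟨fun ⟨_, h⟩ => h.symm, fun h => ⟨0, h.symm⟩⟩

theorem exists_mem_sub (S : Ty Atom .sub) : ∃ R, R ∈ S := by
  cases S with
  | inter n R => exact ⟨R 0, 0, rfl⟩

theorem exists_mem_typ (T : Ty Atom .typ) : ∃ S, S ∈ T := by
  cases T with
  | union n S => exact ⟨S 0, 0, rfl⟩

instance (S : Ty Atom .sub) : Nonempty {R // R ∈ S} :=
  let ⟨R, h⟩ := exists_mem_sub S; ⟨R, h⟩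

instance (T : Ty Atom .typ) : Nonempty {S // S ∈ T} :=
  let ⟨S, h⟩ := exists_mem_typ T; ⟨S, h⟩

instance (S : Ty Atom .sub) : Finite {R // R ∈ S} := by
  cases S with
  | inter n R => exact Set.finite_range R

instance (T : Ty Atom .typ) : Finite {S // S ∈ T} := by
  cases T with
  | union n S => exact Set.finite_range S

/-- The intersection of a finite nonempty family of raw types. -/
theorem exists_inter {ι : Type*} [Finite ι] [Nonempty ι] (R : ι → Ty Atom .raw) :
    ∃ S : Ty Atom .sub, ∀ A, A ∈ S ↔ ∃ i, R i = A := by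
  obtain ⟨n, ⟨e⟩⟩ := Finite.exists_equiv_fin ι
  cases n with
  | zero => exact (e (Classical.arbitrary ι)).elim0
  | succ n =>
    refine ⟨.inter n fun i => R (e.symm i), fun A => ?_⟩
    rw [mem_inter]
    exact ⟨fun ⟨i, h⟩ => ⟨_, h⟩, fun ⟨i, h⟩ => ⟨e i, by simpa using h⟩⟩

/-- The union of a finite nonempty family of subsidiary types. -/
theorem exists_union {ι : Type*} [Finite ι] [Nonempty ι] (S : ι → Ty Atom .sub) :
    ∃ T : Ty Atom .typ, ∀ A, A ∈ T ↔ ∃ i, S i = A := by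
  obtain ⟨n, ⟨e⟩⟩ := Finite.exists_equiv_fin ι
  cases n with
  | zero => exact (e (Classical.arbitrary ι)).elim0
  | succ n =>
    refine ⟨.union n fun i => S (e.symm i), fun A => ?_⟩
    rw [mem_union]
    exact ⟨fun ⟨i, h⟩ => ⟨_, h⟩, fun ⟨i, h⟩ => ⟨e i, by simpa using h⟩⟩

/-- The intersection of a finite nonempty family of subsidiary types. -/
theorem exists_iInter {ι : Type*} [Finite ι] [Nonempty ι] (S : ι → Ty Atom .sub) :
    ∃ S' : Ty Atom .sub, ∀ A, A ∈ S' ↔ ∃ i, A ∈ S i := by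
  have : Nonempty (Σ i, {R // R ∈ S i}) := ⟨⟨Classical.arbitrary ι, Classical.arbitrary _⟩⟩
  obtain ⟨S', h⟩ := exists_inter fun x : (Σ i, {R // R ∈ S i}) => x.2.1
  exact ⟨S', fun A => (h A).trans
    ⟨fun ⟨⟨i, R, hR⟩, h⟩ => ⟨i, h ▸ hR⟩, fun ⟨i, hA⟩ => ⟨⟨i, A, hA⟩, rfl⟩⟩⟩

/-- The union of a finite nonempty family of types. -/
theorem exists_iUnion {ι : Type*} [Finite ι] [Nonempty ι] (T : ι → Ty Atom .typ) :
    ∃ T' : Ty Atom .typ, ∀ A, A ∈ T' ↔ ∃ i, A ∈ T i := by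
  have : Nonempty (Σ i, {S // S ∈ T i}) := ⟨⟨Classical.arbitrary ι, Classical.arbitrary _⟩⟩
  obtain ⟨T', h⟩ := exists_union fun x : (Σ i, {S // S ∈ T i}) => x.2.1
  exact ⟨T', fun A => (h A).trans
    ⟨fun ⟨⟨i, S, hS⟩, h⟩ => ⟨i, h ▸ hS⟩, fun ⟨i, hA⟩ => ⟨⟨i, A, hA⟩, rfl⟩⟩⟩

theorem le_sub_iff {S S' : Ty Atom .sub} : Le S S' ↔ ∀ R' ∈ S', ∃ R ∈ S, Le R R' := by
  constructor
  · rintro (_ | _ | ⟨f, h⟩) _ ⟨j, rfl⟩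
    exact ⟨_, ⟨_, rfl⟩, h j⟩
  · intro h
    cases S with
    | inter n R =>
      cases S' with
      | inter m R' =>
        have h' (j : Fin (m + 1)) : ∃ i, Le (R i) (R' j) := by
          obtain ⟨_, ⟨i, rfl⟩, hi⟩ := h (R' j) ⟨j, rfl⟩
          exact ⟨i, hi⟩
        choose f hf using h'
        exact .inter f hf

theorem le_typ_iff {T T' : Ty Atom .typ} : Le T T' ↔ ∀ S ∈ T, ∃ S' ∈ T', Le S S' := by
  constructor
  · rintro (_ | _ | _ | ⟨f, h⟩) _ ⟨j, rfl⟩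
    exact ⟨_, ⟨_, rfl⟩, h j⟩
  · intro h
    cases T with
    | union n S =>
      cases T' with
      | union m S' =>
        have h' (j : Fin (n + 1)) : ∃ i, Le (S j) (S' i) := by
          obtain ⟨_, ⟨i, rfl⟩, hi⟩ := h (S j) ⟨j, rfl⟩
          exact ⟨i, hi⟩
        choose f hf using h'
        exact .union f hf

@[refl] theorem Le.refl {l : Level} (A : Ty Atom l) : Le A A := by
  induction A with
  | atom α => exact .atom α
  | arr S T ihS ihT => exact .arr ihS ihT
  | inter n R ih => exact .inter id ih
  | union n S ih => exact .union id ih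

theorem Le.trans {l : Level} {A B C : Ty Atom l} (h : Le A B) (h' : Le B C) : Le A C := by
  -- both sides are needed at once, since arrows are contravariant in their domains
  suffices H : (∀ C, Le B C → Le A C) ∧ (∀ C, Le C A → Le C B) from H.1 C h'
  clear h' C
  induction h with
  | atom α => exact ⟨fun _ h => h, fun _ h => h⟩
  | arr _ _ ihS ihT =>
    constructor
    · rintro _ (_ | ⟨hS, hT⟩)
      exact .arr (ihS.2 _ hS) (ihT.1 _ hT)
    · rintro _ (_ | ⟨hS, hT⟩)
      exact .arr (ihS.1 _ hS) (ihT.2 _ hT)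
  | inter f _ ih =>
    constructor
    · rintro _ (_ | _ | ⟨g, hg⟩)
      exact .inter (fun j => f (g j)) fun j => (ih _).1 _ (hg j)
    · rintro _ (_ | _ | ⟨g, hg⟩)
      exact .inter (fun j => g (f j)) fun j => (ih j).2 _ (hg _)
  | union f _ ih =>
    constructor
    · rintro _ (_ | _ | _ | ⟨g, hg⟩)
      exact .union (fun j => g (f j)) fun j => (ih j).1 _ (hg _)
    · rintro _ (_ | _ | _ | ⟨g, hg⟩)
      exact .union (fun j => f (g j)) fun j => (ih _).2 _ (hg j)

theorem le_of_subset {T T' : Ty Atom .typ} (h : ∀ S ∈ T, S ∈ T') : Le T T' :=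
  le_typ_iff.2 fun S hS => ⟨S, h S hS, .refl S⟩

theorem ofSub_le_iff {S : Ty Atom .sub} {T : Ty Atom .typ} :
    Le (ofSub S) T ↔ ∃ S' ∈ T, Le S S' := by
  rw [le_typ_iff]
  simp

end Ty

/-! ### A syntax-directed form of the type system -/

open Ty (Le)

/-- Typing with environments that assign types to all variables, defined by recursion on the
expression. Subtyping is built into the clauses, and unions and intersections enter only through
their members. -/
def HasType : {s : Kind} → Expr s → (ℕ → Ty Atom .sub) → Res Atom s → (ℕ → Ty Atom .typ) → Prop
  | _, .var x, Γ, .ty T, _ => ∃ S ∈ T, Le (Γ x) S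
  | _, .lam M, Γ, .ty T, Δ =>
      ∃ S ∈ T, ∀ R ∈ S, ∃ S₀ T₀, R = .arr S₀ T₀ ∧ HasType M (scons S₀ Γ) (.ty T₀) Δ
  | _, .app M N, Γ, .ty T, Δ =>
      ∃ T₀, HasType M Γ (.ty T₀) Δ ∧
        ∀ S ∈ T₀, ∃ T₁, HasType N Γ (.ty T₁) Δ ∧ ∀ S' ∈ T₁, ∃ R ∈ S, Le R (.arr S' T)
  | _, .letIn M N, Γ, ρ, Δ =>
      ∃ T₀, HasType N Γ (.ty T₀) Δ ∧ ∀ S ∈ T₀, HasType M (scons S Γ) ρ Δ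
  | _, .mu J, Γ, .ty T, Δ => HasType J Γ .bot (scons T Δ)
  | _, .jmp k M, Γ, .bot, Δ => HasType M Γ (.ty (Δ k)) Δ

/-- The subtype relation on results. -/
def Res.Le : {s : Kind} → Res Atom s → Res Atom s → Prop
  | _, .ty T, .ty T' => Ty.Le T T'
  | _, .bot, .bot => True

theorem Res.Le.refl {s : Kind} (ρ : Res Atom s) : Res.Le ρ ρ := by
  cases ρ with
  | ty T => exact Ty.Le.refl T
  | bot => trivial

theorem scons_le {l : Level} {A A' : Ty Atom l} {f f' : ℕ → Ty Atom l} (h : Le A A')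
    (hf : ∀ n, Le (f n) (f' n)) (n : ℕ) : Le (scons A f n) (scons A' f' n) := by
  cases n with
  | zero => exact h
  | succ n => exact hf n

theorem HasType.mono {s : Kind} {M : Expr s} {Γ Γ' : ℕ → Ty Atom .sub} {ρ ρ' : Res Atom s}
    {Δ Δ' : ℕ → Ty Atom .typ} (h : HasType M Γ ρ Δ) (hΓ : ∀ n, Le (Γ' n) (Γ n))
    (hρ : Res.Le ρ ρ') (hΔ : ∀ n, Le (Δ n) (Δ' n)) : HasType M Γ' ρ' Δ' := by
  induction M generalizing Γ Γ' Δ Δ' with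
  | var x =>
    cases ρ; cases ρ'
    obtain ⟨S, hS, h⟩ := h
    obtain ⟨S', hS', h'⟩ := Ty.le_typ_iff.1 hρ S hS
    exact ⟨S', hS', (hΓ x).trans (h.trans h')⟩
  | lam M ih =>
    cases ρ; cases ρ'
    obtain ⟨S, hS, h⟩ := h
    obtain ⟨S', hS', h'⟩ := Ty.le_typ_iff.1 hρ S hS
    refine ⟨S', hS', fun R' hR' => ?_⟩
    obtain ⟨R, hR, hle⟩ := Ty.le_sub_iff.1 h' R' hR'
    obtain ⟨S₀, T₀, rfl, hM⟩ := h R hR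
    cases hle with
    | arr h₁ h₂ => exact ⟨_, _, rfl, ih hM (scons_le h₁ hΓ) h₂ hΔ⟩
  | app M N ihM ihN =>
    cases ρ; cases ρ'
    obtain ⟨T₀, hM, h⟩ := h
    refine ⟨T₀, ihM hM hΓ (Res.Le.refl _) hΔ, fun S hS => ?_⟩
    obtain ⟨T₁, hN, h⟩ := h S hS
    refine ⟨T₁, ihN hN hΓ (Res.Le.refl _) hΔ, fun S' hS' => ?_⟩
    obtain ⟨R, hR, hle⟩ := h S' hS'
    exact ⟨R, hR, hle.trans (.arr (.refl _) hρ)⟩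
  | letIn M N ihM ihN =>
    obtain ⟨T₀, hN, h⟩ := h
    exact ⟨T₀, ihN hN hΓ (Res.Le.refl _) hΔ, fun S hS => ihM (h S hS) (scons_le (.refl _) hΓ) hρ hΔ⟩
  | mu J ih =>
    cases ρ; cases ρ'
    exact ih (ρ := .bot) (ρ' := .bot) h hΓ trivial (scons_le hρ hΔ)
  | jmp k M ih =>
    cases ρ; cases ρ'
    exact ih (ρ := .ty _) (ρ' := .ty _) h hΓ (hΔ k) hΔ

theorem HasType.mono_res {M : Expr .term} {Γ : ℕ → Ty Atom .sub} {T T' : Ty Atom .typ}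
    {Δ : ℕ → Ty Atom .typ} (h : HasType M Γ (.ty T) Δ) (hT : Le T T') :
    HasType M Γ (.ty T') Δ :=
  h.mono (fun _ => .refl _) hT fun _ => .refl _

theorem HasType.mono_env {s : Kind} {M : Expr s} {Γ Γ' : ℕ → Ty Atom .sub} {ρ : Res Atom s}
    {Δ Δ' : ℕ → Ty Atom .typ} (h : HasType M Γ ρ Δ) (hΓ : ∀ n, Le (Γ' n) (Γ n))
    (hΔ : ∀ n, Le (Δ n) (Δ' n)) : HasType M Γ' ρ Δ' :=
  h.mono hΓ (.refl _) hΔ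

theorem hasType_rename {s : Kind} (M : Expr s) (f g : ℕ → ℕ) (Γ : ℕ → Ty Atom .sub)
    (ρ : Res Atom s) (Δ : ℕ → Ty Atom .typ) :
    HasType (M.rename f g) Γ ρ Δ ↔ HasType M (fun n => Γ (f n)) ρ (fun n => Δ (g n)) := by
  induction M generalizing f g Γ Δ with
  | var x => cases ρ; exact Iff.rfl
  | lam M ih => cases ρ; simp only [Expr.rename, HasType, ih, scons_comp_liftRen]
  | app M N ihM ihN => cases ρ; simp only [Expr.rename, HasType, ihM, ihN]
  | letIn M N ihM ihN => simp only [Expr.rename, HasType, ihM, ihN, scons_comp_liftRen]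
  | mu J ih => cases ρ; simp only [Expr.rename, HasType, ih, scons_comp_liftRen]
  | jmp k M ih => cases ρ; simp only [Expr.rename, HasType, ih]

theorem hasType_shiftVar {s : Kind} {M : Expr s} {S : Ty Atom .sub} {Γ : ℕ → Ty Atom .sub}
    {ρ : Res Atom s} {Δ : ℕ → Ty Atom .typ} :
    HasType M.shiftVar (scons S Γ) ρ Δ ↔ HasType M Γ ρ Δ :=
  hasType_rename _ _ _ _ _ _

theorem hasType_shiftCont {s : Kind} {M : Expr s} {T : Ty Atom .typ} {Γ : ℕ → Ty Atom .sub}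
    {ρ : Res Atom s} {Δ : ℕ → Ty Atom .typ} :
    HasType M.shiftCont Γ ρ (scons T Δ) ↔ HasType M Γ ρ Δ :=
  hasType_rename _ _ _ _ _ _

theorem hasType_shiftVarUnder {s : Kind} {M : Expr s} {S S' : Ty Atom .sub}
    {Γ : ℕ → Ty Atom .sub} {ρ : Res Atom s} {Δ : ℕ → Ty Atom .typ} :
    HasType M.shiftVarUnder (scons S (scons S' Γ)) ρ Δ ↔ HasType M (scons S Γ) ρ Δ := by
  rw [Expr.shiftVarUnder, hasType_rename, scons_comp_liftRen]
  exact Iff.rfl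

/-- Typing respects the syntactic equality. -/
theorem Expr.Eqv.hasType_iff {s : Kind} {M M' : Expr s} (h : Eqv M M') (Γ : ℕ → Ty Atom .sub)
    (ρ : Res Atom s) (Δ : ℕ → Ty Atom .typ) : HasType M Γ ρ Δ ↔ HasType M' Γ ρ Δ := by
  induction h generalizing Γ Δ with
  | assoc L M N =>
    constructor
    · rintro ⟨T₀, ⟨T₁, hN, hM⟩, hL⟩
      exact ⟨T₁, hN, fun S₁ h₁ => ⟨T₀, hM S₁ h₁, fun S hS => hasType_shiftVarUnder.2 (hL S hS)⟩⟩
    · rintro ⟨T₁, hN, h⟩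
      choose F hF using fun S₁ : {S // S ∈ T₁} => h S₁.1 S₁.2
      obtain ⟨T₀, hT₀⟩ := Ty.exists_iUnion F
      refine ⟨T₀, ⟨T₁, hN, fun S₁ h₁ => ?_⟩, fun S hS => ?_⟩
      · exact (hF ⟨S₁, h₁⟩).1.mono_res (Ty.le_of_subset fun S hS => (hT₀ S).2 ⟨_, hS⟩)
      · obtain ⟨i, hi⟩ := (hT₀ S).1 hS
        exact hasType_shiftVarUnder.1 ((hF i).2 S hi)
  | jmpLet k L M => cases ρ; exact Iff.rfl
  | refl M => exact Iff.rfl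
  | symm _ ih => exact (ih _ _ _).symm
  | trans _ _ ih ih' => exact (ih _ _ _).trans (ih' _ _ _)
  | lam _ ih => cases ρ; simp only [HasType, ih]
  | app h h' ih ih' => cases ρ; simp only [HasType, ih, ih']
  | letIn _ _ ih ih' => simp only [HasType, ih, ih']
  | mu _ ih => cases ρ; simp only [HasType, ih]
  | jmp k _ ih => cases ρ; simp only [HasType, ih]

/-- The typing rules with subtyping, for environments given by lists that are long enough, derive
all judgements of the syntax-directed system. -/
theorem HasType.exists_typing {s : Kind} (M : Expr s) :
    ∃ N : ℕ, ∀ (Γ : ℕ → Ty Atom .sub) (ρ : Res Atom s) (Δ : ℕ → Ty Atom .typ) (n m : ℕ),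
      N ≤ n → N ≤ m → HasType M Γ ρ Δ →
      Typing ((List.range n).map Γ) M ρ ((List.range m).map Δ) := by
  have cons {l : Level} (A : Ty Atom l) (f : ℕ → Ty Atom l) (n : ℕ) :
      A :: (List.range n).map f = (List.range (n + 1)).map (scons A f) := by
    rw [List.range_succ_eq_map, List.map_cons, List.map_map]
    rfl
  induction M with
  | var x =>
    refine ⟨x + 1, fun Γ ρ Δ n m hn _ h => ?_⟩
    cases ρ
    obtain ⟨S, hS, h⟩ := h
    refine .sub (.var (S := Γ x) ?_) (Ty.ofSub_le_iff.2 ⟨S, hS, h⟩)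
    simp only [List.getElem?_map, List.getElem?_range (show x < n by omega), Option.map_some]
  | lam M ih =>
    obtain ⟨N, hN⟩ := ih
    refine ⟨N, fun Γ ρ Δ n m hn hm h => ?_⟩
    cases ρ
    obtain ⟨S, hS, h⟩ := h
    cases S with
    | inter a R =>
      choose S₀ T₀ hR hM using fun i => h (R i) ⟨i, rfl⟩
      obtain rfl : R = fun i => .arr (S₀ i) (T₀ i) := funext hR
      refine .sub (.lam a S₀ T₀ fun i => ?_) (Ty.ofSub_le_iff.2 ⟨_, hS, .refl _⟩)
      rw [cons]
      exact hN _ _ _ _ _ (by omega) hm (hM i)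
  | app M N ihM ihN =>
    obtain ⟨N₁, h₁⟩ := ihM
    obtain ⟨N₂, h₂⟩ := ihN
    refine ⟨max N₁ N₂, fun Γ ρ Δ n m hn hm h => ?_⟩
    cases ρ with
    | ty T =>
    obtain ⟨T₀, hM, h⟩ := h
    cases T₀ with
    | union a S =>
      choose T₁ hN hS using fun i => h (S i) ⟨i, rfl⟩
      have hT₁ (i : Fin (a + 1)) : ∃ (b : ℕ) (S' : Fin (b + 1) → Ty Atom .sub),
          T₁ i = .union b S' := by
        cases T₁ i; exact ⟨_, _, rfl⟩
      choose b S' hS' using hT₁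
      refine .app a b S' T (.sub (h₁ _ _ _ _ _ (by omega) (by omega) hM) ?_) fun i => ?_
      · refine .union id fun i => Ty.le_sub_iff.2 ?_
        rintro _ ⟨j, rfl⟩
        exact hS i (S' i j) (by rw [hS']; exact ⟨j, rfl⟩)
      · rw [← hS' i]
        exact h₂ _ _ _ _ _ (by omega) (by omega) (hN i)
  | letIn M N ihM ihN =>
    obtain ⟨N₁, h₁⟩ := ihM
    obtain ⟨N₂, h₂⟩ := ihN
    refine ⟨max N₁ N₂, fun Γ ρ Δ n m hn hm h => ?_⟩
    obtain ⟨T₀, hN, hM⟩ := h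
    cases T₀ with
    | union a S =>
      refine .letIn a S ρ (fun i => ?_) (h₂ _ _ _ _ _ (by omega) (by omega) hN)
      rw [cons]
      exact h₁ _ _ _ _ _ (by omega) (by omega) (hM _ ⟨i, rfl⟩)
  | mu J ih =>
    obtain ⟨N, hN⟩ := ih
    refine ⟨N, fun Γ ρ Δ n m hn hm h => ?_⟩
    cases ρ
    refine .mu ?_
    rw [cons]
    exact hN _ _ _ _ _ hn (by omega) h
  | jmp k M ih =>
    obtain ⟨N, hN⟩ := ih
    refine ⟨max N (k + 1), fun Γ ρ Δ n m hn hm h => ?_⟩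
    cases ρ
    refine .jmp (T := Δ k) ?_ (hN _ _ _ _ _ (by omega) (by omega) h)
    simp only [List.getElem?_map, List.getElem?_range (show k < m by omega), Option.map_some]

end

/-! ### Subject expansion -/

open CCV.Ty (Le)

section
variable {Atom : Type*}

/-- Typing by a subsidiary type. -/
abbrev HasSubType (V : Expr .term) (Γ : ℕ → Ty Atom .sub) (S : Ty Atom .sub)
    (Δ : ℕ → Ty Atom .typ) : Prop :=
  HasType V Γ (.ty (Ty.ofSub S)) Δ

theorem hasSubType_var {x : ℕ} {Γ : ℕ → Ty Atom .sub} {S : Ty Atom .sub} {Δ : ℕ → Ty Atom .typ} :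
    HasSubType (.var x) Γ S Δ ↔ Le (Γ x) S := by
  simp [HasType]

theorem HasSubType.mono {V : Expr .term} {Γ : ℕ → Ty Atom .sub} {S S' : Ty Atom .sub}
    {Δ : ℕ → Ty Atom .typ} (h : HasSubType V Γ S Δ) (hS : Le S S') : HasSubType V Γ S' Δ :=
  h.mono_res (Ty.ofSub_le_iff.2 ⟨S', Ty.mem_ofSub.2 rfl, hS⟩)

/-- Unions are trivial for values: a value that has type `⋃ᵢ Sᵢ` has one of the types `Sᵢ`. -/
theorem HasType.exists_hasSubType {V : Expr .term} (hV : V.isVal) {Γ : ℕ → Ty Atom .sub}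
    {T : Ty Atom .typ} {Δ : ℕ → Ty Atom .typ} (h : HasType V Γ (.ty T) Δ) :
    ∃ S ∈ T, HasSubType V Γ S Δ := by
  cases V with
  | var x =>
    obtain ⟨S, hS, h⟩ := h
    exact ⟨S, hS, hasSubType_var.2 h⟩
  | lam M =>
    obtain ⟨S, hS, h⟩ := h
    exact ⟨S, hS, S, Ty.mem_ofSub.2 rfl, h⟩
  | _ => cases hV

/-- A value has an intersection type if it has the types that are intersected. -/
theorem HasSubType.inter {V : Expr .term} (hV : V.isVal) {Γ : ℕ → Ty Atom .sub}
    {Δ : ℕ → Ty Atom .typ} {S : Ty Atom .sub}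
    (h : ∀ R ∈ S, ∃ S', R ∈ S' ∧ HasSubType V Γ S' Δ) : HasSubType V Γ S Δ := by
  cases V with
  | var x =>
    refine hasSubType_var.2 (Ty.le_sub_iff.2 fun R hR => ?_)
    obtain ⟨S', hR', h'⟩ := h R hR
    exact Ty.le_sub_iff.1 (hasSubType_var.1 h') R hR'
  | lam M =>
    refine ⟨S, Ty.mem_ofSub.2 rfl, fun R hR => ?_⟩
    obtain ⟨S', hR', S'', hS'', h'⟩ := h R hR
    rw [Ty.mem_ofSub] at hS''
    exact h' R (hS'' ▸ hR')
  | _ => cases hV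

theorem hasSubType_shiftVar {V : Expr .term} {S S' : Ty Atom .sub} {Γ : ℕ → Ty Atom .sub}
    {Δ : ℕ → Ty Atom .typ} :
    HasSubType V.shiftVar (scons S Γ) S' Δ ↔ HasSubType V Γ S' Δ := hasType_shiftVar

/-- The environments that assign to each variable `n` a type of the value `υ n`. -/
def TypesFor (υ : ℕ → Expr .term) (Γ : ℕ → Ty Atom .sub) (Δ : ℕ → Ty Atom .typ) :
    Set (ℕ → Ty Atom .sub) :=
  {Γ' | ∀ n, HasSubType (υ n) Γ (Γ' n) Δ}

theorem TypesFor.exists_le {υ : ℕ → Expr .term} (hυ : ∀ n, (υ n).isVal) {Γ : ℕ → Ty Atom .sub}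
    {Δ : ℕ → Ty Atom .typ} {ι : Type*} [Finite ι] [Nonempty ι] {Γ' : ι → ℕ → Ty Atom .sub}
    (h : ∀ i, Γ' i ∈ TypesFor υ Γ Δ) : ∃ Γ'' ∈ TypesFor υ Γ Δ, ∀ i n, Le (Γ'' n) (Γ' i n) := by
  choose Γ'' h'' using fun n => Ty.exists_iInter fun i => Γ' i n
  refine ⟨Γ'', fun n => .inter (hυ n) fun R hR => ?_, fun i n => Ty.le_sub_iff.2 fun R hR => ?_⟩
  · obtain ⟨i, hi⟩ := (h'' n R).1 hR
    exact ⟨_, hi, h i n⟩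
  · exact ⟨R, (h'' n R).2 ⟨i, hR⟩, .refl R⟩

theorem TypesFor.exists_le₂ {υ : ℕ → Expr .term} (hυ : ∀ n, (υ n).isVal) {Γ : ℕ → Ty Atom .sub}
    {Δ : ℕ → Ty Atom .typ} {Γ₁ Γ₂ : ℕ → Ty Atom .sub} (h₁ : Γ₁ ∈ TypesFor υ Γ Δ)
    (h₂ : Γ₂ ∈ TypesFor υ Γ Δ) :
    ∃ Γ' ∈ TypesFor υ Γ Δ, (∀ n, Le (Γ' n) (Γ₁ n)) ∧ ∀ n, Le (Γ' n) (Γ₂ n) := by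
  obtain ⟨Γ', h, h'⟩ := TypesFor.exists_le (ι := Bool) (Γ' := fun b => cond b Γ₁ Γ₂) hυ
    (Γ := Γ) (Δ := Δ) (by rintro (_ | _); exacts [h₂, h₁])
  exact ⟨Γ', h, h' true, h' false⟩

theorem typesFor_liftSubst {υ : ℕ → Expr .term} {Γ Γ' : ℕ → Ty Atom .sub} {S : Ty Atom .sub}
    {Δ : ℕ → Ty Atom .typ} :
    Γ' ∈ TypesFor (Expr.liftSubst υ) (scons S Γ) Δ ↔
      Le S (Γ' 0) ∧ (fun n => Γ' (n + 1)) ∈ TypesFor υ Γ Δ := by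
  constructor
  · intro h
    exact ⟨hasSubType_var.1 (h 0), fun n => hasSubType_shiftVar.1 (h (n + 1))⟩
  · rintro ⟨h, h'⟩ (_ | n)
    · exact hasSubType_var.2 h
    · exact hasSubType_shiftVar.2 (h' n)

/-- Subject expansion for a substitution of values, all of which have to be typeable. -/
theorem HasType.of_subst {s : Kind} {M : Expr s} {υ : ℕ → Expr .term} (hυ : ∀ n, (υ n).isVal)
    {Γ : ℕ → Ty Atom .sub} {ρ : Res Atom s} {Δ : ℕ → Ty Atom .typ}
    (hne : (TypesFor υ Γ Δ).Nonempty) (h : HasType (M.subst υ) Γ ρ Δ) :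
    ∃ Γ' ∈ TypesFor υ Γ Δ, HasType M Γ' ρ Δ := by
  -- the passage under a binder of an ordinary variable
  have under {s : Kind} {M : Expr s} {υ : ℕ → Expr .term} {Γ : ℕ → Ty Atom .sub} {ρ : Res Atom s}
      {Δ : ℕ → Ty Atom .typ} {S : Ty Atom .sub} (hne : (TypesFor υ Γ Δ).Nonempty)
      (ih : (TypesFor (Expr.liftSubst υ) (scons S Γ) Δ).Nonempty →
        ∃ Γ' ∈ TypesFor (Expr.liftSubst υ) (scons S Γ) Δ, HasType M Γ' ρ Δ) :
      ∃ Γ' ∈ TypesFor υ Γ Δ, HasType M (scons S Γ') ρ Δ := by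
    obtain ⟨Γ₀, h₀⟩ := hne
    obtain ⟨Γ', h', hM⟩ := ih ⟨scons S Γ₀, typesFor_liftSubst.2 ⟨.refl _, h₀⟩⟩
    obtain ⟨hS, h'⟩ := typesFor_liftSubst.1 h'
    refine ⟨_, h', hM.mono_env ?_ fun _ => .refl _⟩
    rintro (_ | n)
    exacts [hS, .refl _]
  induction M generalizing υ Γ Δ with
  | var x =>
    cases ρ with
    | ty T =>
    obtain ⟨S, hS, h⟩ := h.exists_hasSubType (hυ x)
    obtain ⟨Γ₀, h₀⟩ := hne
    refine ⟨Function.update Γ₀ x S, fun n => ?_, S, hS, by rw [Function.update_self]⟩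
    by_cases hn : n = x
    · subst hn; rwa [Function.update_self]
    · rw [Function.update_of_ne hn]; exact h₀ n
  | lam M ih =>
    cases ρ with
    | ty T =>
    obtain ⟨S, hS, h⟩ := h
    choose S₀ T₀ hR hM using fun R : {R // R ∈ S} => h R.1 R.2
    choose Γ' hΓ' hM' using fun R => under hne fun hne' =>
      ih (Expr.isVal_liftSubst hυ) hne' (hM R)
    obtain ⟨Γ'', hΓ'', hle⟩ := TypesFor.exists_le hυ hΓ'
    exact ⟨Γ'', hΓ'', S, hS, fun R hR' => ⟨_, _, hR ⟨R, hR'⟩,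
      (hM' ⟨R, hR'⟩).mono_env (scons_le (.refl _) (hle _)) fun _ => .refl _⟩⟩
  | app M N ihM ihN =>
    cases ρ with
    | ty T =>
    obtain ⟨T₀, hM, h⟩ := h
    choose T₁ hN hT₁ using fun S : {S // S ∈ T₀} => h S.1 S.2
    obtain ⟨Γ₁, hΓ₁, hM⟩ := ihM hυ hne hM
    choose Γ' hΓ' hN' using fun S => ihN hυ hne (hN S)
    obtain ⟨Γ₂, hΓ₂, hle⟩ := TypesFor.exists_le hυ hΓ'
    obtain ⟨Γ'', hΓ'', hle₁, hle₂⟩ := TypesFor.exists_le₂ hυ hΓ₁ hΓ₂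
    exact ⟨Γ'', hΓ'', T₀, hM.mono_env hle₁ fun _ => .refl _, fun S hS => ⟨T₁ ⟨S, hS⟩,
      (hN' ⟨S, hS⟩).mono_env (fun n => (hle₂ n).trans (hle _ n)) fun _ => .refl _, hT₁ ⟨S, hS⟩⟩⟩
  | letIn M N ihM ihN =>
    obtain ⟨T₀, hN, h⟩ := h
    obtain ⟨Γ₁, hΓ₁, hN⟩ := ihN hυ hne hN
    choose Γ' hΓ' hM' using fun S : {S // S ∈ T₀} => under hne fun hne' =>
      ihM (Expr.isVal_liftSubst hυ) hne' (h S.1 S.2)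
    obtain ⟨Γ₂, hΓ₂, hle⟩ := TypesFor.exists_le hυ hΓ'
    obtain ⟨Γ'', hΓ'', hle₁, hle₂⟩ := TypesFor.exists_le₂ hυ hΓ₁ hΓ₂
    exact ⟨Γ'', hΓ'', T₀, hN.mono_env hle₁ fun _ => .refl _, fun S hS =>
      (hM' ⟨S, hS⟩).mono_env (scons_le (.refl _) fun n => (hle₂ n).trans (hle _ n))
        fun _ => .refl _⟩
  | mu J ih =>
    cases ρ with
    | ty T =>
    have hT : TypesFor (fun n => (υ n).shiftCont) Γ (scons T Δ) = TypesFor υ Γ Δ :=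
      Set.ext fun Γ' => forall_congr' fun n => hasType_shiftCont
    have := ih (υ := fun n => (υ n).shiftCont) (ρ := .bot)
      (fun n => by rw [Expr.shiftCont, Expr.isVal_rename]; exact hυ n) (hT ▸ hne) h
    rwa [hT] at this
  | jmp k M ih =>
    cases ρ
    exact ih hυ hne (ρ := .ty _) h

/-- Subject expansion for the substitution `M{V/x}`. -/
theorem HasType.of_inst {s : Kind} {M : Expr s} {V : Expr .term} (hV : V.isVal)
    {Γ : ℕ → Ty Atom .sub} {ρ : Res Atom s} {T : Ty Atom .typ} {Δ : ℕ → Ty Atom .typ}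
    (hT : HasType V Γ (.ty T) Δ) (h : HasType (M.inst V) Γ ρ Δ) :
    HasType (.letIn M V) Γ ρ Δ := by
  obtain ⟨S, _, hS⟩ := hT.exists_hasSubType hV
  obtain ⟨Γ', hΓ', hM⟩ := HasType.of_subst (by rintro (_ | n); exacts [hV, rfl])
    ⟨scons S Γ, by rintro (_ | n); exacts [hS, hasSubType_var.2 (.refl _)]⟩ h
  refine ⟨_, hΓ' 0, fun S' hS' => ?_⟩
  rw [Ty.mem_ofSub] at hS'
  subst hS'
  refine hM.mono_env ?_ fun _ => .refl _
  rintro (_ | n)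
  exacts [.refl _, (hasSubType_var (Δ := Δ)).1 (hΓ' (n + 1))]

/-- The types of the argument for which the body `M` of a let-expression has the type `T`. -/
def ArgTypes (M : Expr .term) (Γ : ℕ → Ty Atom .sub) (T : Ty Atom .typ) (Δ : ℕ → Ty Atom .typ) :
    Set (Ty Atom .typ) :=
  {T' | ∀ S ∈ T', HasType M (scons S Γ) (.ty T) Δ}

theorem ArgTypes.exists_le {M : Expr .term} {Γ : ℕ → Ty Atom .sub} {T : Ty Atom .typ}
    {Δ : ℕ → Ty Atom .typ} {ι : Type*} [Finite ι] [Nonempty ι] {T' : ι → Ty Atom .typ}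
    (h : ∀ i, T' i ∈ ArgTypes M Γ T Δ) : ∃ T'' ∈ ArgTypes M Γ T Δ, ∀ i, Le (T' i) T'' := by
  obtain ⟨T'', h''⟩ := Ty.exists_iUnion T'
  refine ⟨T'', fun S hS => ?_, fun i => Ty.le_of_subset fun S hS => (h'' S).2 ⟨i, hS⟩⟩
  obtain ⟨i, hi⟩ := (h'' S).1 hS
  exact h i S hi

theorem ArgTypes.exists_le₂ {M : Expr .term} {Γ : ℕ → Ty Atom .sub} {T : Ty Atom .typ}
    {Δ : ℕ → Ty Atom .typ} {T₁ T₂ : Ty Atom .typ} (h₁ : T₁ ∈ ArgTypes M Γ T Δ)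
    (h₂ : T₂ ∈ ArgTypes M Γ T Δ) : ∃ T' ∈ ArgTypes M Γ T Δ, Le T₁ T' ∧ Le T₂ T' := by
  obtain ⟨T', h, h'⟩ := ArgTypes.exists_le (ι := Bool) (T' := fun b => cond b T₁ T₂) (M := M)
    (Γ := Γ) (T := T) (Δ := Δ) (by rintro (_ | _); exacts [h₂, h₁])
  exact ⟨T', h, h' true, h' false⟩

theorem update_le {Δ : ℕ → Ty Atom .typ} {k : ℕ} {T T' : Ty Atom .typ} (h : Le T T') (n : ℕ) :
    Le (Function.update Δ k T n) (Function.update Δ k T' n) := by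
  by_cases hn : n = k
  · subst hn; rwa [Function.update_self, Function.update_self]
  · rw [Function.update_of_ne hn, Function.update_of_ne hn]

/-- Subject expansion for a context substitution. -/
theorem HasType.of_ctxSubst {s : Kind} {P : Expr s} {k : ℕ} {M : Expr .term}
    {Γ : ℕ → Ty Atom .sub} {ρ : Res Atom s} {Δ : ℕ → Ty Atom .typ}
    (hne : (ArgTypes M Γ (Δ k) Δ).Nonempty) (h : HasType (P.ctxSubst k M) Γ ρ Δ) :
    ∃ T ∈ ArgTypes M Γ (Δ k) Δ, HasType P Γ ρ (Function.update Δ k T) := by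
  have under {M : Expr .term} {Γ : ℕ → Ty Atom .sub} {S : Ty Atom .sub} {T : Ty Atom .typ}
      {Δ : ℕ → Ty Atom .typ} :
      ArgTypes M.shiftVarUnder (scons S Γ) T Δ = ArgTypes M Γ T Δ :=
    Set.ext fun T' => forall₂_congr fun S hS => hasType_shiftVarUnder
  induction P generalizing k M Γ Δ with
  | var x =>
    cases ρ
    obtain ⟨T, hT⟩ := hne
    exact ⟨T, hT, h⟩
  | lam P ih =>
    cases ρ with
    | ty T =>
    obtain ⟨S, hS, h⟩ := h
    choose S₀ T₀ hR hP using fun R : {R // R ∈ S} => h R.1 R.2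
    choose T' hT' hP' using fun R => ih (M := M.shiftVarUnder) (by rwa [under]) (hP R)
    simp only [under] at hT'
    obtain ⟨T'', hT'', hle⟩ := ArgTypes.exists_le hT'
    exact ⟨T'', hT'', S, hS, fun R hR' => ⟨_, _, hR ⟨R, hR'⟩,
      (hP' ⟨R, hR'⟩).mono_env (fun _ => .refl _) (update_le (hle _))⟩⟩
  | app P Q ihP ihQ =>
    cases ρ with
    | ty T =>
    obtain ⟨T₀, hP, h⟩ := h
    choose T₁ hQ hT₁ using fun S : {S // S ∈ T₀} => h S.1 S.2
    obtain ⟨U₁, hU₁, hP⟩ := ihP hne hP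
    choose T' hT' hQ' using fun S => ihQ hne (hQ S)
    obtain ⟨U₂, hU₂, hle⟩ := ArgTypes.exists_le hT'
    obtain ⟨U, hU, hle₁, hle₂⟩ := ArgTypes.exists_le₂ hU₁ hU₂
    exact ⟨U, hU, T₀, hP.mono_env (fun _ => .refl _) (update_le hle₁), fun S hS => ⟨T₁ ⟨S, hS⟩,
      (hQ' ⟨S, hS⟩).mono_env (fun _ => .refl _) (update_le ((hle _).trans hle₂)), hT₁ ⟨S, hS⟩⟩⟩
  | letIn P Q ihP ihQ =>
    obtain ⟨T₀, hQ, h⟩ := h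
    obtain ⟨U₁, hU₁, hQ⟩ := ihQ hne hQ
    choose T' hT' hP' using fun S : {S // S ∈ T₀} =>
      ihP (M := M.shiftVarUnder) (by rwa [under]) (h S.1 S.2)
    simp only [under] at hT'
    obtain ⟨U₂, hU₂, hle⟩ := ArgTypes.exists_le hT'
    obtain ⟨U, hU, hle₁, hle₂⟩ := ArgTypes.exists_le₂ hU₁ hU₂
    exact ⟨U, hU, T₀, hQ.mono_env (fun _ => .refl _) (update_le hle₁), fun S hS =>
      (hP' ⟨S, hS⟩).mono_env (fun _ => .refl _) (update_le ((hle _).trans hle₂))⟩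
  | mu J ih =>
    cases ρ with
    | ty T =>
    have hA : ArgTypes M.shiftCont Γ (scons T Δ (k + 1)) (scons T Δ) = ArgTypes M Γ (Δ k) Δ :=
      Set.ext fun T' => forall₂_congr fun S hS => hasType_shiftCont
    obtain ⟨T', hT', hJ⟩ := ih (k := k + 1) (M := M.shiftCont) (ρ := .bot) (hA ▸ hne) h
    refine ⟨T', hA ▸ hT', ?_⟩
    rw [← scons_update] at hJ
    exact hJ
  | jmp l P ih =>
    cases ρ
    rw [Expr.ctxSubst] at h
    split_ifs at h with hl
    · subst hl
      obtain ⟨T₀, hP, hM⟩ := h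
      obtain ⟨T₁, hT₁, hP⟩ := ih hne hP
      obtain ⟨U, hU, hle₁, hle₂⟩ := ArgTypes.exists_le₂ (T₁ := T₀) hM hT₁
      refine ⟨U, hU, ?_⟩
      simp only [HasType, Function.update_self]
      exact hP.mono (fun _ => .refl _) hle₁ (update_le hle₂)
    · obtain ⟨T', hT', hP⟩ := ih (ρ := .ty _) hne h
      refine ⟨T', hT', ?_⟩
      simp only [HasType, Function.update_of_ne hl]
      exact hP

/-- Subject expansion for `M⟨x := μk.J⟩`. Since `k` need not occur in `J`, the body `M` has to be
typeable with the type of the reduct. -/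
theorem HasType.of_betaMu {M : Expr .term} {J : Expr .jump} {Γ : ℕ → Ty Atom .sub}
    {T : Ty Atom .typ} {Δ : ℕ → Ty Atom .typ} {S : Ty Atom .sub}
    (hM : HasType M (scons S Γ) (.ty T) Δ)
    (h : HasType (.mu (J.ctxSubst 0 M.shiftCont)) Γ (.ty T) Δ) :
    HasType (.letIn M (.mu J)) Γ (.ty T) Δ := by
  have hne : Ty.ofSub S ∈ ArgTypes M.shiftCont Γ (scons T Δ 0) (scons T Δ) := fun S' hS' => by
    rw [Ty.mem_ofSub] at hS'
    subst hS'
    exact hasType_shiftCont.2 hM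
  obtain ⟨T', hT', hJ⟩ := HasType.of_ctxSubst (ρ := .bot) ⟨_, hne⟩ h
  have he : Function.update (scons T Δ) 0 T' = scons T' Δ := by
    funext n; cases n <;> rfl
  rw [he] at hJ
  exact ⟨T', hJ, fun S hS => hasType_shiftCont.1 (hT' S hS)⟩

theorem HasType.of_ad₁ {M N : Expr .term} {Γ : ℕ → Ty Atom .sub} {ρ : Res Atom .term}
    {Δ : ℕ → Ty Atom .typ} (h : HasType (.letIn (.app (.var 0) M.shiftVar) N) Γ ρ Δ) :
    HasType (.app N M) Γ ρ Δ := by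
  cases ρ
  obtain ⟨T₀, hN, h⟩ := h
  refine ⟨T₀, hN, fun S hS => ?_⟩
  obtain ⟨T₁, ⟨S₁, hS₁, hle⟩, h⟩ := h S hS
  obtain ⟨T₂, hM, h⟩ := h S₁ hS₁
  refine ⟨T₂, hasType_shiftVar.1 hM, fun S' hS' => ?_⟩
  obtain ⟨R, hR, hR'⟩ := h S' hS'
  obtain ⟨R₀, hR₀, hle'⟩ := Ty.le_sub_iff.1 hle R hR
  exact ⟨R₀, hR₀, hle'.trans hR'⟩

theorem HasType.of_ad₂ {V N : Expr .term} (hV : V.isVal) {Γ : ℕ → Ty Atom .sub}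
    {ρ : Res Atom .term} {Δ : ℕ → Ty Atom .typ}
    (h : HasType (.letIn (.app V.shiftVar (.var 0)) N) Γ ρ Δ) : HasType (.app V N) Γ ρ Δ := by
  cases ρ with
  | ty T =>
  obtain ⟨T₀, hN, h⟩ := h
  have hS (S : Ty Atom .sub) (hS : S ∈ T₀) : HasSubType V Γ (Ty.ofRaw (.arr S T)) Δ := by
    obtain ⟨T₁, hV', h⟩ := h S hS
    obtain ⟨S₁, hS₁, hV'⟩ :=
      hV'.exists_hasSubType (by rw [Expr.shiftVar, Expr.isVal_rename, hV])
    obtain ⟨T₂, ⟨S₂, hS₂, hle⟩, h⟩ := h S₁ hS₁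
    obtain ⟨R, hR, hR'⟩ := h S₂ hS₂
    refine (hasSubType_shiftVar.1 hV').mono (Ty.le_sub_iff.2 fun R' hR'' => ⟨R, hR, ?_⟩)
    rw [Ty.mem_ofRaw.1 hR'']
    exact hR'.trans (.arr hle (.refl _))
  obtain ⟨S', hS'⟩ := Ty.exists_inter fun S : {S // S ∈ T₀} => Ty.arr S.1 T
  refine ⟨Ty.ofSub S', HasSubType.inter hV fun R hR => ?_, fun S hS => ⟨T₀, hN, fun S'' hS'' => ?_⟩⟩
  · obtain ⟨S, rfl⟩ := (hS' R).1 hR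
    exact ⟨_, Ty.mem_ofRaw.2 rfl, hS S.1 S.2⟩
  · rw [Ty.mem_ofSub] at hS
    subst hS
    exact ⟨_, (hS' _).2 ⟨⟨S'', hS''⟩, rfl⟩, .refl _⟩

theorem HasType.of_betaLam {M V : Expr .term} (hV : V.isVal) {Γ : ℕ → Ty Atom .sub}
    {ρ : Res Atom .term} {Δ : ℕ → Ty Atom .typ} (h : HasType (.letIn M V) Γ ρ Δ) :
    HasType (.app (.lam M) V) Γ ρ Δ := by
  cases ρ with
  | ty T =>
  obtain ⟨T₀, hT₀, h⟩ := h
  obtain ⟨S, hS, hV⟩ := hT₀.exists_hasSubType hV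
  refine ⟨Ty.ofSub (Ty.ofRaw (.arr S T)), ⟨_, Ty.mem_ofSub.2 rfl, fun R hR => ?_⟩,
    fun S' hS' => ⟨_, hV, fun S'' hS'' => ?_⟩⟩
  · exact ⟨S, T, Ty.mem_ofRaw.1 hR, h S hS⟩
  · rw [Ty.mem_ofSub] at hS' hS''
    subst hS' hS''
    exact ⟨_, Ty.mem_ofRaw.2 rfl, .refl _⟩

/-! ### Strongly normalizable terms are typeable -/

variable (Atom) in
/-- Typeability in the syntax-directed system. -/
def Expr.IsTypeable {s : Kind} (M : Expr s) : Prop :=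
  ∃ (Γ : ℕ → Ty Atom .sub) (ρ : Res Atom s) (Δ : ℕ → Ty Atom .typ), HasType M Γ ρ Δ

namespace Expr

/-- Number of constructors. -/
def size : {s : Kind} → Expr s → ℕ
  | _, var _ => 1
  | _, lam M => M.size + 1
  | _, app M N => M.size + N.size + 1
  | _, letIn M N => M.size + N.size + 1
  | _, mu J => J.size + 1
  | _, jmp _ M => M.size + 1

theorem size_pos {s : Kind} (M : Expr s) : 0 < M.size := by
  cases M <;> simp [size]

theorem size_rename {s : Kind} (M : Expr s) (f g : ℕ → ℕ) : (M.rename f g).size = M.size := by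
  induction M generalizing f g with
  | var x => rfl
  | lam M ih => simp only [rename, size, ih]
  | app M N ihM ihN => simp only [rename, size, ihM, ihN]
  | letIn M N ihM ihN => simp only [rename, size, ihM, ihN]
  | mu J ih => simp only [rename, size, ih]
  | jmp k M ih => simp only [rename, size, ih]

/-- Every jump is, up to the syntactic equality, of the form `[k]M`. -/
theorem exists_eqv_jmp (J : Expr .jump) : ∃ k M, Eqv J (jmp k M) ∧ (jmp k M).size = J.size := by
  suffices H : ∀ (s : Kind) (J : Expr s), s = .jump → ∃ k M,
      ∀ h : s = .jump, Eqv (h ▸ J) (jmp k M) ∧ (jmp k M).size = J.size by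
    obtain ⟨k, M, h⟩ := H _ J rfl
    exact ⟨k, M, h rfl⟩
  intro s J
  induction J with
  | var | lam | app | mu => intro h; cases h
  | letIn J N ih =>
    rintro rfl
    obtain ⟨k, M, h⟩ := ih rfl
    obtain ⟨h, hs⟩ := h rfl
    refine ⟨k, .letIn M N, fun _ => ⟨(Eqv.letIn h (.refl N)).trans (.symm (.jmpLet k M N)), ?_⟩⟩
    simp only [size] at hs ⊢
    omega
  | jmp k M => exact fun _ => ⟨k, M, fun _ => ⟨.refl _, rfl⟩⟩

end Expr

/-- One-hole contexts, given as functions that preserve the syntactic equality and reduction. -/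
structure IsContext {s : Kind} (C : Expr s → Expr .term) : Prop where
  eqv : ∀ {M N}, Expr.Eqv M N → Expr.Eqv (C M) (C N)
  step : ∀ {M N}, Expr.Step M N → Expr.Step (C M) (C N)

section
variable {s : Kind} {C : Expr s → Expr .term}

theorem IsContext.letBody (hC : IsContext C) (N : Expr .term) :
    IsContext fun M => C (.letIn M N) :=
  ⟨fun h => hC.eqv (.letIn h (.refl N)), fun h => hC.step (.letBody N h)⟩

theorem IsContext.letArg (hC : IsContext C) (M : Expr s) : IsContext fun N => C (.letIn M N) :=
  ⟨fun h => hC.eqv (.letIn (.refl M) h), fun h => hC.step (.letArg M h)⟩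

end

section
variable {C : Expr .term → Expr .term}

theorem IsContext.lam (hC : IsContext C) : IsContext fun M => C (.lam M) :=
  ⟨fun h => hC.eqv (.lam h), fun h => hC.step (.lam h)⟩

theorem IsContext.appRight (hC : IsContext C) (M : Expr .term) :
    IsContext fun N => C (.app M N) :=
  ⟨fun h => hC.eqv (.app (.refl M) h), fun h => hC.step (.appRight M h)⟩

theorem IsContext.mu (hC : IsContext C) : IsContext fun J => C (.mu J) :=
  ⟨fun h => hC.eqv (.mu h), fun h => hC.step (.mu h)⟩

theorem IsContext.jmp {C : Expr .jump → Expr .term} (hC : IsContext C) (k : ℕ) :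
    IsContext fun M => C (.jmp k M) :=
  ⟨fun h => hC.eqv (.jmp k h), fun h => hC.step (.jmp k h)⟩

end

theorem Expr.IsTypeable.of_eqv {s : Kind} {M N : Expr s} (h : Expr.Eqv M N)
    (hN : N.IsTypeable Atom) : M.IsTypeable Atom :=
  let ⟨Γ, ρ, Δ, hN⟩ := hN
  ⟨Γ, ρ, Δ, (h.hasType_iff _ _ _).2 hN⟩

/-- Two environments have a common refinement. -/
theorem exists_common_env (Γ₁ Γ₂ : ℕ → Ty Atom .sub) (Δ₁ Δ₂ : ℕ → Ty Atom .typ) :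
    ∃ (Γ : ℕ → Ty Atom .sub) (Δ : ℕ → Ty Atom .typ),
      ((∀ n, Le (Γ n) (Γ₁ n)) ∧ ∀ n, Le (Δ₁ n) (Δ n)) ∧
      ((∀ n, Le (Γ n) (Γ₂ n)) ∧ ∀ n, Le (Δ₂ n) (Δ n)) := by
  choose Γ hΓ using fun n => Ty.exists_iInter fun b => cond b (Γ₁ n) (Γ₂ n)
  choose Δ hΔ using fun n => Ty.exists_iUnion fun b => cond b (Δ₁ n) (Δ₂ n)
  exact ⟨Γ, Δ,
    ⟨fun n => Ty.le_sub_iff.2 fun R hR => ⟨R, (hΓ n R).2 ⟨true, hR⟩, .refl R⟩,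
      fun n => Ty.le_of_subset fun S hS => (hΔ n S).2 ⟨true, hS⟩⟩,
    ⟨fun n => Ty.le_sub_iff.2 fun R hR => ⟨R, (hΓ n R).2 ⟨false, hR⟩, .refl R⟩,
      fun n => Ty.le_of_subset fun S hS => (hΔ n S).2 ⟨false, hS⟩⟩⟩

/-- An application `x V` of a variable to a typeable value has any given type. -/
theorem Expr.IsTypeable.app_var (x : ℕ) {V : Expr .term} (hV : V.isVal)
    (h : V.IsTypeable Atom) (T : Ty Atom .typ) :
    ∃ (Γ : ℕ → Ty Atom .sub) (Δ : ℕ → Ty Atom .typ), HasType (.app (.var x) V) Γ (.ty T) Δ := by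
  obtain ⟨Γ, ρ, Δ, h⟩ := h
  cases ρ with
  | ty T' =>
  obtain ⟨S, _, h⟩ := h.exists_hasSubType hV
  obtain ⟨Γ', Δ', ⟨hΓ, hΔ⟩, hΓ', hΔ'⟩ :=
    exists_common_env Γ (fun _ => Ty.ofRaw (.arr S T)) Δ Δ
  refine ⟨Γ', Δ', Ty.ofSub (Ty.ofRaw (.arr S T)), hasSubType_var.2 (hΓ' x), fun S' hS' =>
    ⟨_, h.mono_env hΓ hΔ, fun S'' hS'' => ?_⟩⟩
  rw [Ty.mem_ofSub] at hS' hS''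
  subst hS' hS''
  exact ⟨_, Ty.mem_ofRaw.2 rfl, .refl _⟩

theorem Expr.IsTypeable.letIn_of_arg {M N N' : Expr .term}
    (h : ∀ (Γ : ℕ → Ty Atom .sub) ρ Δ, HasType N' Γ ρ Δ → HasType N Γ ρ Δ)
    (h' : (Expr.letIn M N').IsTypeable Atom) : (Expr.letIn M N).IsTypeable Atom :=
  let ⟨Γ, ρ, Δ, T₀, hN, hM⟩ := h'
  ⟨Γ, ρ, Δ, T₀, h _ _ _ hN, hM⟩

/-- Every subexpression of a strongly normalizable term is typeable. The induction is on the
strong normalizability of the term and the size of the subexpression. Reductions of the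
subexpression are reductions of the term, so that the subexpressions of a reduct are covered as
well; size decides only among the subexpressions of one term. -/
theorem Term.StronglyNormalizable.isTypeable [Nonempty Atom] {a : Term}
    (ha : a.StronglyNormalizable) {s : Kind} {N : Expr s} {C : Expr s → Expr .term}
    (hC : IsContext C) (hN : Term.mk (C N) = a) : N.IsTypeable Atom := by
  induction ha generalizing s with
  | intro a _ iha =>
  induction hn : N.size using Nat.strong_induction_on generalizing s with
  | _ n ihn =>
  let α : Ty Atom .sub := Ty.ofRaw (.atom (Classical.arbitrary Atom))
  have step {s : Kind} {C : Expr s → Expr .term} (hC : IsContext C) {N N' : Expr s}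
      (hN : Term.mk (C N) = a) (h : Expr.Step N N') : N'.IsTypeable Atom :=
    iha _ ⟨_, _, hN, rfl, hC.step h⟩ hC rfl
  have mk_eq {s : Kind} {C : Expr s → Expr .term} (hC : IsContext C) {N N' : Expr s}
      (hN : Term.mk (C N) = a) (h : Expr.Eqv N N') : Term.mk (C N') = a :=
    (Quotient.sound (s := Expr.eqvSetoid .term) (hC.eqv h.symm)).trans hN
  cases s with
  | jump =>
    -- `[k]M` is typed by adding the type of `M` to the type of `k`
    obtain ⟨k, M, h, hs⟩ := N.exists_eqv_jmp
    refine .of_eqv h ?_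
    obtain ⟨Γ, ρ, Δ, hM⟩ := ihn M.size (by simp only [Expr.size] at hs; omega) (hC.jmp k)
      (mk_eq hC hN h) rfl
    cases ρ with
    | ty T =>
    obtain ⟨Γ', Δ', ⟨hΓ, hΔ⟩, -, hΔ'⟩ := exists_common_env Γ Γ Δ fun _ => T
    exact ⟨Γ', .bot, Δ', hM.mono hΓ (hΔ' k) hΔ⟩
  | term =>
  -- nested let-expressions in the argument are reassociated until the argument is not one
  have hlet {M N : Expr .term} (hsz : (Expr.letIn M N).size ≤ n)
      (hN : Term.mk (C (.letIn M N)) = a) : (Expr.letIn M N).IsTypeable Atom := by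
    induction hm : N.size using Nat.strong_induction_on generalizing M N with
    | _ m ihm =>
    subst hm
    have hposM := M.size_pos
    have hposN := N.size_pos
    simp only [Expr.size] at hsz
    have hM : M.IsTypeable Atom := ihn M.size (by omega) (hC.letBody N) hN rfl
    have hN' : N.IsTypeable Atom := ihn N.size (by omega) (hC.letArg M) hN rfl
    by_cases hV : N.isVal
    · obtain ⟨Γ₁, ρ₁, Δ₁, h₁⟩ := step hC hN (.betaLet M (Expr.isVal_iff.1 hV))
      obtain ⟨Γ₂, ρ₂, Δ₂, h₂⟩ := hN'
      cases ρ₂ with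
      | ty T =>
      obtain ⟨Γ, Δ, ⟨hΓ₁, hΔ₁⟩, hΓ₂, hΔ₂⟩ := exists_common_env Γ₁ Γ₂ Δ₁ Δ₂
      exact ⟨Γ, ρ₁, Δ, .of_inst hV (h₂.mono_env hΓ₂ hΔ₂) (h₁.mono_env hΓ₁ hΔ₁)⟩
    cases N with
    | var | lam => exact absurd rfl hV
    | letIn M₁ N₁ =>
      refine .of_eqv (.assoc M M₁ N₁) (ihm N₁.size ?_ ?_ (mk_eq hC hN (.assoc M M₁ N₁)) rfl)
      · have := M₁.size_pos; simp only [Expr.size]; omega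
      · simp only [Expr.size, Expr.shiftVarUnder, Expr.size_rename] at hsz ⊢; omega
    | mu J =>
      obtain ⟨Γ₁, ρ₁, Δ₁, h₁⟩ := step hC hN (.betaMu M J)
      obtain ⟨Γ₂, ρ₂, Δ₂, h₂⟩ := hM
      cases ρ₁ with
      | ty T₁ =>
      cases ρ₂ with
      | ty T₂ =>
      obtain ⟨Γ, Δ, ⟨hΓ₁, hΔ₁⟩, hΓ₂, hΔ₂⟩ :=
        exists_common_env Γ₁ (fun n => Γ₂ (n + 1)) Δ₁ Δ₂
      -- the reduct and the body `M` are given the union of their types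
      obtain ⟨T, hT⟩ := Ty.exists_iUnion fun b => cond b T₁ T₂
      have hT₁ : Le T₁ T := Ty.le_of_subset fun S hS => (hT S).2 ⟨true, hS⟩
      have hT₂ : Le T₂ T := Ty.le_of_subset fun S hS => (hT S).2 ⟨false, hS⟩
      refine ⟨Γ, .ty T, Δ, .of_betaMu (S := Γ₂ 0) (h₂.mono ?_ hT₂ hΔ₂) (h₁.mono hΓ₁ hT₁ hΔ₁)⟩
      rintro (_ | n)
      exacts [.refl _, hΓ₂ n]
    | app P Q =>
      by_cases hP : P.isVal
      · by_cases hQ : Q.isVal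
        · cases P with
          | var x =>
            -- the type of the result of `x Q` is chosen according to the type of `y` in `M`
            obtain ⟨Γ₁, ρ, Δ₁, h₁⟩ := hM
            have hQ' : Q.IsTypeable Atom := ihn Q.size
              (by simp only [Expr.size] at hsz; omega)
              ((hC.letArg M).appRight (.var x)) hN rfl
            obtain ⟨Γ₂, Δ₂, h₂⟩ := hQ'.app_var x hQ (Ty.ofSub (Γ₁ 0))
            obtain ⟨Γ, Δ, ⟨hΓ₁, hΔ₁⟩, hΓ₂, hΔ₂⟩ :=
              exists_common_env (fun n => Γ₁ (n + 1)) Γ₂ Δ₁ Δ₂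
            refine ⟨Γ, ρ, Δ, _, h₂.mono_env hΓ₂ hΔ₂, fun S hS => h₁.mono_env ?_ hΔ₁⟩
            rw [Ty.mem_ofSub] at hS
            subst hS
            rintro (_ | n)
            exacts [.refl _, hΓ₁ n]
          | lam P =>
            exact .letIn_of_arg (fun _ _ _ => .of_betaLam hQ)
              (step hC hN (.letArg M (.betaLam P (Expr.isVal_iff.1 hQ))))
          | _ => cases hP
        · exact .letIn_of_arg (fun _ _ _ => .of_ad₂ hP)
            (step hC hN (.letArg M (.ad₂ (Expr.isVal_iff.1 hP) (Expr.isVal_iff.not.1 hQ))))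
      · exact .letIn_of_arg (fun _ _ _ => .of_ad₁)
          (step hC hN (.letArg M (.ad₁ Q (Expr.isVal_iff.not.1 hP))))
  cases N with
  | var x => exact ⟨fun _ => α, .ty (Ty.ofSub α), fun _ => Ty.ofSub α, hasSubType_var.2 (.refl α)⟩
  | lam M =>
    obtain ⟨Γ, ρ, Δ, hM⟩ := ihn M.size (by simp only [Expr.size] at hn; omega) hC.lam hN rfl
    cases ρ with
    | ty T =>
    refine ⟨fun n => Γ (n + 1), .ty (Ty.ofSub (Ty.ofRaw (.arr (Γ 0) T))), Δ, _,
      Ty.mem_ofSub.2 rfl, fun R hR => ⟨_, _, Ty.mem_ofRaw.1 hR, hM.mono_env ?_ fun _ => .refl _⟩⟩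
    rintro (_ | n) <;> exact .refl _
  | app P Q =>
    by_cases hP : P.isVal
    · by_cases hQ : Q.isVal
      · cases P with
        | var x =>
          have hQ' : Q.IsTypeable Atom :=
            ihn Q.size (by simp only [Expr.size] at hn; omega) (hC.appRight _) hN rfl
          obtain ⟨Γ, Δ, h⟩ := hQ'.app_var x hQ (Ty.ofSub α)
          exact ⟨Γ, _, Δ, h⟩
        | lam P =>
          obtain ⟨Γ, ρ, Δ, h⟩ := step hC hN (.betaLam P (Expr.isVal_iff.1 hQ))
          exact ⟨Γ, ρ, Δ, .of_betaLam hQ h⟩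
        | _ => cases hP
      · obtain ⟨Γ, ρ, Δ, h⟩ :=
          step hC hN (.ad₂ (Expr.isVal_iff.1 hP) (Expr.isVal_iff.not.1 hQ))
        exact ⟨Γ, ρ, Δ, .of_ad₂ hP h⟩
    · obtain ⟨Γ, ρ, Δ, h⟩ := step hC hN (.ad₁ Q (Expr.isVal_iff.not.1 hP))
      exact ⟨Γ, ρ, Δ, .of_ad₁ h⟩
  | letIn M N => exact hlet hn.le hN
  | mu J =>
    obtain ⟨Γ, ρ, Δ, hJ⟩ := ihn J.size (by simp only [Expr.size] at hn; omega) hC.mu hN rfl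
    cases ρ
    refine ⟨Γ, .ty (Δ 0), fun n => Δ (n + 1), hJ.mono_env (fun _ => .refl _) ?_⟩
    rintro (_ | n) <;> exact .refl _

end

end CCV

theorem mainTheorem1 (Atom : Type*) [Nonempty Atom] (M : CCV.Term) :
    M.StronglyNormalizable ↔ M.Typeable Atom := by
  constructor
  · intro h
    obtain ⟨N, rfl⟩ := Quotient.exists_rep M
    obtain ⟨Γ, ρ, Δ, hN⟩ := h.isTypeable (Atom := Atom) (C := id) ⟨id, id⟩ rfl
    cases ρ with
    | ty T =>
    obtain ⟨n, hn⟩ := CCV.HasType.exists_typing (Atom := Atom) N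
    exact ⟨N, _, T, _, rfl, hn Γ _ Δ n n le_rfl le_rfl hN⟩
  · exact CCV.Term.Typeable.stronglyNormalizable
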